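/- Let $k$ be a field and let $A$ be a finite-dimensional $k$-algebra. Write $A\text{-mod}$ for the category of finitely generated left $A$-modules, $J(A)$ for the Jacobson radical, and $\mathrm{add}(M)$ for the full subcategory of direct summands of finite direct sums of copies of $M$. Definitions (each minimum is $\infty$ if no such integer exists). * The Loewy length $\mathrm{ll}(A)$ is the smallest $i$ with $J(A)^i=0$. * $\mathrm{repdim}(A)$ is the smallest integer $i\ge 2$ for which there is $M\in A\text{-mod}$ such that for every $L\in A\text{-mod}$: (a) there is an exact sequence $0\to M^{-i+2}\to\cdots\to M^0\to L\to 0$ with $M^j\in\mathrm{add}(M)$ that stays exact under $\mathrm{Hom}(M,-)$; and (b) there is an exact sequence $0\to L\to M'^0\to\cdots\to M'^{\,i-2}\to 0$ with $M'^j\in\mathrm{add}(M)$ that stays exact under $\mathrm{Hom}(-,M)$. * $\mathrm{wrepdim}(A)$ is the smallest integer $i\ge 2$ for which there is $M\in A\text{-mod}$ such that for every $L\in A\text{-mod}$ there is a bounded complex $C=(0\to C^r\to\cdots\to C^s\to 0)$ of objects of $\mathrm{add}(M)$ with $s-r\le i-2$, $H^d(C)=0$ for $d\ne 0$, and $L$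 isomorphic to a direct summand of $H^0(C)$. * For a triangulated category $\mathcal T$ and a class $\mathcal I$ of objects, $\langle\mathcal I\rangle$ is the smallest full subcategory containing $\mathcal I$ and closed under finite direct sums, direct summands and shifts; $\langle\mathcal I\rangle_0=0$, and $\langle\mathcal I\rangle_{i+1}=\langle\,\langle\mathcal I\rangle_i*\langle\mathcal I\rangle\,\rangle$, where $\mathcal I_1*\mathcal I_2$ consists of the objects $Y$ in distinguished triangles $X\to Y\to Z\to X[1]$ with $X\in\mathcal I_1$, $Z\in\mathcal I_2$. The dimension $\dim\mathcal T$ is the smallest $d\ge 0$ such that $\mathcal T=\langle M\rangle_{d+1}$ for some object $M$. * $A\text{-perf}$ is the smallest thick subcategory of $D^b(A\text{-mod})$ containing $A$. For $A$ self-injective (that is, injective as a module over itself), $A\text{-stab}$ is the quotient of $A\text{-mod}$ by the maps factoring through finitely generated projective modules, with its usual triangulated structure: $X[1]=\Omega^{-1}X$, and the distinguished triangles come from short exact sequences of modules. **Proposition.** For every finite-dimensional $k$-algebra $A$, $$\dim\bigl(D^b(A\text{-mod})/A\text{-perf}\bigr)\le \mathrm{wrepdim}(A)-2 .$$ If moreover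 $A$ is self-injective and not semisimple, then $$\mathrm{ll}(A)\ \ge\ \mathrm{repdim}(A)\ \ge\ \mathrm{wrepdim}(A)\ \ge\ 2+\dim(A\text{-stab}).$$ -/

import Mathlib

universe u v

namespace RepDim

open CategoryTheory CategoryTheory.Limits Opposite Pretriangulated

noncomputable section

/-! ### Dimension of a triangulated category -/

section Dimension

variable {C : Type u} [Category.{v} C]

/-- The part of a triangulated structure that is used in the definition of the dimension:
`IsShift X Y` says that `Y` is isomorphic to `X[1]`, and `IsTriangle f g` says that the two maps
`f : X ⟶ Y` and `g : Y ⟶ Z` are the first two maps of some distinguished triangle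
`X ⟶ Y ⟶ Z ⟶ X[1]`. -/
structure TriangleData (C : Type u) [Category.{v} C] where
  IsShift : C → C → Prop
  IsTriangle : ∀ {X Y Z : C}, (X ⟶ Y) → (Y ⟶ Z) → Prop

/-- The shift and the distinguished triangles of a (pre)triangulated category. -/
def TriangleData.ofPretriangulated (C : Type u) [Category.{v} C] [HasZeroObject C]
    [HasShift C ℤ] [Preadditive C] [∀ n : ℤ, (shiftFunctor C n).Additive] [Pretriangulated C] :
    TriangleData C where
  IsShift X Y := Nonempty (Y ≅ X⟦(1 : ℤ)⟧)
  IsTriangle {X _ Z} f g := ∃ h : Z ⟶ X⟦(1 : ℤ)⟧, Triangle.mk f g h ∈ distTriang C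

namespace TriangleData

variable (D : TriangleData C)

/-- `⟨P⟩`: the smallest full subcategory that contains `P` and is closed under finite direct sums
(the zero object and sums of two objects), direct summands (in particular isomorphisms) and
shifts in both directions. In an additive category, finite products are finite direct sums. -/
inductive Span (P : ObjectProperty C) : C → Prop
  | of {X : C} (hX : P X) : Span P X
  | zero {X : C} (hX : IsZero X) : Span P X
  | sum {X Y : C} (c : BinaryFan X Y) (hc : IsLimit c) (hX : Span P X) (hY : Span P Y) :
      Span P c.pt
  | summand {X Y : C} (r : Retract X Y) (hY : Span P Y) : Span P X
  | shift {X Y : C} (h : D.IsShift X Y) (hX : Span P X) : Span P Y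
  | unshift {X Y : C} (h : D.IsShift X Y) (hY : Span P Y) : Span P X

/-- `P ∗ Q`: the objects `Y` that sit in a distinguished triangle `X ⟶ Y ⟶ Z ⟶ X[1]` with `X` in
`P` and `Z` in `Q`. -/
def Star (P Q : ObjectProperty C) : ObjectProperty C := fun Y =>
  ∃ (X Z : C) (f : X ⟶ Y) (g : Y ⟶ Z), D.IsTriangle f g ∧ P X ∧ Q Z

/-- `⟨P⟩ᵢ`: `⟨P⟩₀ = 0` and `⟨P⟩ᵢ₊₁ = ⟨ ⟨P⟩ᵢ ∗ ⟨P⟩ ⟩`. -/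
def SpanIter (P : ObjectProperty C) : ℕ → ObjectProperty C
  | 0 => fun X => IsZero X
  | i + 1 => D.Span (D.Star (SpanIter P i) (D.Span P))

/-- The dimension: the minimal `d ≥ 0` such that every object is in `⟨M⟩_{d+1}` for some object
`M`, and `∞` if there is no such `d`. -/
def dim : ℕ∞ :=
  sInf {d : ℕ∞ | ∃ n : ℕ, d = n ∧
    ∃ M : C, ∀ X : C, D.SpanIter (fun Y => Nonempty (Y ≅ M)) (n + 1) X}

end TriangleData

end Dimension

/-! ### Representation dimensions of an abelian category -/

section RepresentationDimension

variable {C : Type u} [Category.{v} C] [Abelian C]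

attribute [local instance] Abelian.hasFiniteBiproducts

/-- `add(M)`: the direct summands of finite direct sums of copies of `M`. -/
def InAdd (M : C) : ObjectProperty C := fun X =>
  ∃ n : ℕ, Nonempty (Retract X (⨁ fun _ : Fin n => M))

/-- There is an exact sequence `0 → M_{i-1} → ⋯ → M_1 → L → 0` with terms `M_j` in `add(M)` that
stays exact under `Hom(M, -)`. The whole sequence is the complex `E`, with `L` in degree `0`. -/
def HasAddResolution (M L : C) (i : ℕ) : Prop :=
  ∃ E : ChainComplex C ℕ, Nonempty (E.X 0 ≅ L) ∧ (∀ j, InAdd M (E.X (j + 1))) ∧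
    (∀ j, i ≤ j → IsZero (E.X j)) ∧ E.Acyclic ∧
    (((preadditiveCoyoneda.obj (op M)).mapHomologicalComplex _).obj E).Acyclic

/-- There is an exact sequence `0 → L → M_1 → ⋯ → M_{i-1} → 0` with terms `M_j` in `add(M)` that
stays exact under `Hom(-, M)`. The whole sequence is the complex `E`, with `L` in degree `0`. -/
def HasAddCoresolution (M L : C) (i : ℕ) : Prop :=
  ∃ E : CochainComplex C ℕ, Nonempty (E.X 0 ≅ L) ∧ (∀ j, InAdd M (E.X (j + 1))) ∧
    (∀ j, i ≤ j → IsZero (E.X j)) ∧ E.Acyclic ∧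
    (((preadditiveYoneda.obj M).mapHomologicalComplex _).obj E.op).Acyclic

/-- There is a bounded complex `0 → K^r → ⋯ → K^s → 0` with terms in `add(M)`, with `s - r ≤ i - 2`
and with cohomology concentrated in degree `0`, such that `L` is a direct summand of `H⁰(K)`. -/
def HasWeakAddResolution (M L : C) (i : ℕ) : Prop :=
  ∃ (K : CochainComplex C ℤ) (r s : ℤ), s - r ≤ (i : ℤ) - 2 ∧
    (∀ d, InAdd M (K.X d)) ∧ (∀ d, d < r → IsZero (K.X d)) ∧ (∀ d, s < d → IsZero (K.X d)) ∧
    (∀ d, d ≠ 0 → K.ExactAt d) ∧ Nonempty (Retract L (K.homology 0))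

variable (C)

/-- The (Auslander) representation dimension of an abelian category (`∞` if no `i` works). -/
def repdim : ℕ∞ :=
  sInf {d : ℕ∞ | ∃ i : ℕ, d = i ∧ 2 ≤ i ∧
    ∃ M : C, ∀ L : C, HasAddResolution M L i ∧ HasAddCoresolution M L i}

/-- The weak representation dimension of an abelian category (`∞` if no `i` works). -/
def wrepdim : ℕ∞ :=
  sInf {d : ℕ∞ | ∃ i : ℕ, d = i ∧ 2 ≤ i ∧ ∃ M : C, ∀ L : C, HasWeakAddResolution M L i}

end RepresentationDimension

/-! ### Loewy length -/

/-- The Loewy length of a ring: the smallest `i` with `J(A)^i = 0` (`∞` if there is none). -/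
def loewyLength (A : Type u) [Ring A] : ℕ∞ :=
  sInf {d : ℕ∞ | ∃ i : ℕ, d = i ∧ Ring.jacobson A ^ i = ⊥}

section Modules

variable (A : Type u) [Ring A]

/-! ### The stable category -/

/-- Two maps of finitely generated modules are identified in the stable category if their
difference factors through a finitely generated projective module. -/
def stableRel : HomRel (FGModuleCat.{u} A) := fun X Y f g =>
  ∃ (P : FGModuleCat.{u} A) (a : X ⟶ P) (b : P ⟶ Y), Module.Projective A P ∧ a ≫ b = f - g

/-- The stable category `A-stab`, the quotient of `A-mod` by `A-proj`. -/
abbrev Stab : Type (u + 1) := Quotient (stableRel A)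

/-- The quotient functor `A-mod ⥤ A-stab`. -/
abbrev toStab : FGModuleCat.{u} A ⥤ Stab A := Quotient.functor (stableRel A)

variable [IsNoetherianRing A]

/-- The triangulated structure of the stable category of a self-injective algebra. If
`0 → X → P → Y → 0` is exact with `P` projective (equivalently, injective), then `Y = X[1]`; the
distinguished triangles are those that are isomorphic in `A-stab` to the triangle
`X ⟶ Y ⟶ Z ⟶ X[1]` of a short exact sequence `0 → X → Y → Z → 0` of modules. -/
def stabTriangleData : TriangleData (Stab A) where
  IsShift X Y := ∃ S : ShortComplex (FGModuleCat.{u} A), S.ShortExact ∧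
    Module.Projective A S.X₂ ∧ Nonempty (X ≅ (toStab A).obj S.X₁) ∧
    Nonempty (Y ≅ (toStab A).obj S.X₃)
  IsTriangle {X Y Z} f g := ∃ S : ShortComplex (FGModuleCat.{u} A), S.ShortExact ∧
    ∃ (e₁ : X ≅ (toStab A).obj S.X₁) (e₂ : Y ≅ (toStab A).obj S.X₂)
      (e₃ : Z ≅ (toStab A).obj S.X₃),
      f ≫ e₂.hom = e₁.hom ≫ (toStab A).map S.f ∧ g ≫ e₃.hom = e₂.hom ≫ (toStab A).map S.g

/-- `dim A-stab`. -/
def dimStab : ℕ∞ := (stabTriangleData A).dim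

/-! ### The quotient of the bounded derived category by the perfect complexes -/

instance hasDerivedCategoryFGMod : HasDerivedCategory.{u + 1} (FGModuleCat.{u} A) :=
  HasDerivedCategory.standard _

/-- `D^b(A-mod)`: the objects of the derived category of `A-mod` with bounded cohomology. -/
abbrev BoundedDerived : Type (u + 1) :=
  (DerivedCategory.TStructure.t (C := FGModuleCat.{u} A)).bounded.FullSubcategory

/-- The module `A`, as a complex in degree `0`, is an object of `D^b(A-mod)`. -/
def regularComplex : BoundedDerived A :=
  ⟨(DerivedCategory.singleFunctor (FGModuleCat.{u} A) 0).obj (FGModuleCat.of A A),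
    ⟨0, inferInstance⟩, ⟨0, inferInstance⟩⟩

/-- `A-perf`: the smallest thick subcategory of `D^b(A-mod)` that contains `A`. -/
abbrev perf : ObjectProperty (BoundedDerived A) :=
  (ObjectProperty.singleton (regularComplex A)).triangEnvelope

/-- The Verdier quotient `D^b(A-mod)/A-perf`: the localization of `D^b(A-mod)` at the maps whose
cone is in `A-perf`. -/
abbrev StableDerived : Type (u + 1) := (perf A).trW.Localization

/-- `dim (D^b(A-mod)/A-perf)`. -/
def dimStableDerived : ℕ∞ := (TriangleData.ofPretriangulated (StableDerived A)).dim

end Modules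

end

end RepDim

/-!
Both triangulated categories receive a functor `Φ` from `A-mod` that sends projective modules to
zero and short exact sequences to triangles (`IsStabilization`). For such a functor, let `K` be a
complex in `add(M)` with cohomology concentrated in degree `0`. The cocycles in degrees `d ≥ 0` are
built from `Φ M` by downward induction on `d`, because `K^d` is an extension of the cocycles in
degree `d + 1` by those in degree `d`. The terms in negative degrees resolve the coboundaries in
degree `0`; replacing the cohomology by its syzygies moves them one at a time to the other side of
the extension, which does not change the generated subcategory, as syzygies are negative shifts
(`IsStabilization.spanIter_cokernel`). So `Φ L` is built from `Φ M` in as many steps as `K` has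
terms. This bounds the dimension as soon as `Φ` is essentially surjective up to shift
(`IsStabilization.two_add_dim_le_wrepdim`). For the stable category this is clear. For the quotient
by the perfect complexes, a bounded complex receives a map from a projective module in its top
degree that is surjective on the top cohomology; the cone has a shorter range of cohomology and is
isomorphic to the complex in the quotient (`exists_span_of_bounded`).

For `repdim ≤ ll`, let `J ^ n = 0` and let `M` be the sum of the modules `A ⧸ J ^ j` with `j ≤ n`. A
module killed by `J ^ (m + 1)` has an approximation by `add(M)` whose kernel is killed by `J ^ m`
(`exists_approximation`), so it has an `add(M)`-resolution with `m + 1` terms that stays exact under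
`Hom(M, -)`. If `A` is self-injective, then every module is the sum of a projective module and a
module killed by `J ^ (n - 1)` (`exists_isCompl_projective`), so `n - 1` terms are enough for all
modules. The coresolutions come for free: maps of modules to powers of `M` are controlled by a
dimension shift along the resolutions (`coresLen_of_resLen`). It is used here that every module
embeds in a power of `M`, because a self-injective Artinian ring is a cogenerator
(`exists_ne_zero_of_ne_zero`).

For `wrepdim ≤ repdim`, drop the last term of a resolution: what is left has cohomology `L`.
-/

namespace RepDim

open CategoryTheory CategoryTheory.Limits Opposite Pretriangulated

/-! ### Additive closures -/

section Additive

variable {C : Type*} [Category* C] [Preadditive C] [HasFiniteBiproducts C]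
  [HasBinaryBiproducts C]

/-- A finite direct sum of `n + 1` copies is a retract of a direct sum of `n` copies and one
further copy. -/
noncomputable def retractBiproductSucc (M : C) (n : ℕ) :
    Retract (⨁ fun _ : Fin (n + 1) => M) ((⨁ fun _ : Fin n => M) ⊞ M) where
  i := biprod.lift (biproduct.lift fun j => biproduct.π _ j.castSucc)
    (biproduct.π _ (Fin.last n))
  r := biprod.desc (biproduct.desc fun j => biproduct.ι (fun _ : Fin (n + 1) => M) j.castSucc)
    (biproduct.ι (fun _ : Fin (n + 1) => M) (Fin.last n))
  retract := by
    rw [biprod.lift_desc, biproduct.lift_desc, ← biproduct.total, Fin.sum_univ_castSucc]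

/-- A class of objects that contains `M` and the zero objects and is closed under binary direct
sums and direct summands contains all of `add(M)`. -/
theorem of_retract_biproduct {P : ObjectProperty C} (hz : ∀ X, IsZero X → P X)
    (hs : ∀ X Y, P X → P Y → P (X ⊞ Y)) (hr : ∀ X Y, Retract X Y → P Y → P X)
    {M X : C} (hM : P M) {n : ℕ} (r : Retract X (⨁ fun _ : Fin n => M)) : P X := by
  refine hr _ _ r ?_
  clear r
  induction n with
  | zero =>
    refine hz _ ((IsZero.iff_id_eq_zero _).2 ?_)
    ext j
    exact j.elim0
  | succ n ih => exact hr _ _ (retractBiproductSucc M n) (hs _ _ ih hM)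

end Additive

open scoped ZeroObject

/-! ### Stabilization functors -/

section Stabilization

variable {C : Type*} [Category* C] [Abelian C] {T : Type*} [Category* T]

namespace TriangleData

variable {D : TriangleData T} {P : ObjectProperty T}

theorem Span.of_iso {X Y : T} (e : X ≅ Y) (h : D.Span P Y) : D.Span P X :=
  .summand ⟨e.hom, e.inv, e.hom_inv_id⟩ h

theorem Span.biprod [Preadditive T] (Φ : C ⥤ T) [Φ.Additive] {X Y : C}
    (hX : D.Span P (Φ.obj X)) (hY : D.Span P (Φ.obj Y)) : D.Span P (Φ.obj (X ⊞ Y)) := by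
  have := Φ.preservesFiniteBiproductsOfAdditive
  have := preservesBinaryBiproducts_of_preservesBiproducts Φ
  exact .sum _ (isBinaryBilimitOfPreserves Φ (BinaryBiproduct.isBilimit X Y)).isLimit hX hY

end TriangleData

/-- The properties shared by the functors from an abelian category `C` to its stable category and
to the quotient of its bounded derived category by the perfect complexes: projective objects go to
zero, and short exact sequences go to triangles. -/
structure IsStabilization (D : TriangleData T) (Φ : C ⥤ T) : Prop where
  isZero : ∀ P : C, Projective P → IsZero (Φ.obj P)
  isShift : ∀ S : ShortComplex C, S.ShortExact → Projective S.X₂ →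
    D.IsShift (Φ.obj S.X₁) (Φ.obj S.X₃)
  isTriangle : ∀ S : ShortComplex C, S.ShortExact → D.IsTriangle (Φ.map S.f) (Φ.map S.g)

/-- The kernel of an epimorphism, as a short exact sequence. -/
theorem shortExact_kernel {X Y : C} (f : X ⟶ Y) [Epi f] :
    (ShortComplex.mk (kernel.ι f) f (kernel.condition f)).ShortExact where
  exact := ShortComplex.exact_kernel f
  mono_f := inferInstance
  epi_g := inferInstance

/-- If `K` is exact in degree `d + 1`, then `K^d` is an extension of the cocycles in degree `d + 1` by
those in degree `d`. -/
theorem shortExact_cycles (K : CochainComplex C ℤ) (d e : ℤ) (hde : d + 1 = e)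
    (he : K.ExactAt e) :
    (ShortComplex.mk (K.iCycles d) (K.toCycles d e) (by
      rw [← cancel_mono (K.iCycles e)]; simp)).ShortExact where
  exact := by
    rw [ShortComplex.exact_iff_exact_up_to_refinements]
    intro A x hx
    dsimp at x hx
    have hx' : x ≫ K.d d e = 0 := by rw [← K.toCycles_i d e, reassoc_of% hx, zero_comp]
    exact ⟨A, 𝟙 A, inferInstance, K.liftCycles x e (by simp [← hde]) hx', by simp⟩
  mono_f := by dsimp; infer_instance
  epi_g := by
    rw [epi_iff_surjective_up_to_refinements]
    intro A y
    dsimp at y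
    obtain ⟨A', ρ, hρ, x, hx⟩ := (K.exactAt_iff_exact_up_to_refinements d e (e + 1)
      (by simp [← hde]) (by simp)).1 he (y ≫ K.iCycles e) (by simp)
    exact ⟨A', ρ, hρ, x, by rw [← cancel_mono (K.iCycles e)]; simpa using hx⟩

theorem exact_toCycles (K : CochainComplex C ℤ) (a b c : ℤ)
    (h : (ShortComplex.mk _ _ (K.d_comp_d a b c)).Exact) :
    (ShortComplex.mk (K.d a b) (K.toCycles b c) (by simp)).Exact :=
  (ShortComplex.exact_iff_of_epi_of_isIso_of_mono
    (S₁ := ShortComplex.mk (K.d a b) (K.toCycles b c) (by simp))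
    (S₂ := ShortComplex.mk _ _ (K.d_comp_d a b c))
    { τ₁ := 𝟙 _, τ₂ := 𝟙 _, τ₃ := K.iCycles c }).2 h

namespace IsStabilization

variable [Preadditive T] {D : TriangleData T} {Φ : C ⥤ T} [Φ.Additive]
  {P : ObjectProperty T} (h : IsStabilization D Φ)

include h

theorem spanIter_one {X : C} (hX : D.Span P (Φ.obj X)) : D.SpanIter P 1 (Φ.obj X) := by
  let S : ShortComplex C := ShortComplex.mk (0 : (0 : C) ⟶ X) (𝟙 X) (by simp)
  have hS : S.ShortExact :=
    { exact := (S.exact_iff_mono rfl).2 (by dsimp [S]; infer_instance)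
      mono_f := by dsimp [S]; infer_instance
      epi_g := by dsimp [S]; infer_instance }
  refine .of ⟨_, _, _, _, h.isTriangle S hS, ?_, hX⟩
  exact Φ.map_isZero (isZero_zero C)

variable [EnoughProjectives C]

omit [Preadditive T] [Φ.Additive] in
/-- Rotation of a triangle, at the level of short exact sequences: given an epimorphism from a
projective object `Q` to the right-hand term, the pullback is an extension of the middle term by
the syzygy, and it is the direct sum of the left-hand term and `Q`. -/
theorem spanIter_left {S : ShortComplex C} (hS : S.ShortExact) {n : ℕ}
    (h₂ : D.Span P (Φ.obj S.X₂)) (h₃ : D.SpanIter P (n + 1) (Φ.obj S.X₃)) :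
    D.SpanIter P (n + 2) (Φ.obj S.X₁) := by
  have := hS.mono_f
  have := hS.epi_g
  let q := Projective.π S.X₃
  let s : Projective.over S.X₃ ⟶ S.X₂ := Projective.factorThru q S.g
  have hs : s ≫ S.g = q := Projective.factorThru_comp _ _
  let i : kernel q ⟶ pullback S.g q := pullback.lift 0 (kernel.ι q) (by simp)
  have wi : i ≫ pullback.fst S.g q = 0 := pullback.lift_fst _ _ _
  have wi' : i ≫ pullback.snd S.g q = kernel.ι q := pullback.lift_snd _ _ _
  let S' := ShortComplex.mk i (pullback.fst S.g q) wi
  have hi : Mono i := mono_of_mono_fac wi'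
  have hS' : S'.ShortExact :=
    { exact := by
        refine S'.exact_of_f_is_kernel (KernelFork.IsLimit.ofι' i wi fun {A} k hk => ?_)
        refine ⟨kernel.lift q (k ≫ pullback.snd S.g q) ?_, ?_⟩
        · simp [← pullback.condition, reassoc_of% hk]
        · apply pullback.hom_ext
          · rw [Category.assoc, wi, comp_zero, hk]
          · rw [Category.assoc, wi', kernel.lift_ι]
      mono_f := hi
      epi_g := by dsimp [S']; infer_instance }
  -- the section `s` of `S.g` over `q` splits the pullback
  let r : pullback S.g q ⟶ S.X₁ := hS.exact.lift
    (pullback.fst S.g q - pullback.snd S.g q ≫ s) (by simp [hs, pullback.condition])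
  have hr : r ≫ S.f = pullback.fst S.g q - pullback.snd S.g q ≫ s := hS.exact.lift_f _ _
  let R : Retract S.X₁ (pullback S.g q) :=
    { i := pullback.lift S.f 0 (by simp)
      r := r
      retract := by
        rw [← cancel_mono S.f, Category.assoc, hr, Preadditive.comp_sub, pullback.lift_fst,
          pullback.lift_snd_assoc, zero_comp, sub_zero, Category.id_comp] }
  refine .summand (R.map Φ) (.of ⟨_, _, _, _, h.isTriangle S' hS', ?_, h₂⟩)
  exact .unshift (h.isShift (.mk (kernel.ι q) q (kernel.condition q)) (shortExact_kernel q)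
    (Projective.projective_over _)) h₃

/-- Let `⋯ → X 1 → X 0 → Z → H → 0` be exact. Replacing `Z` by the kernel of an epimorphism
`X 0 ⊞ Q → Z`, with `Q` projective, replaces `H` by a syzygy and drops `X 0`. After finitely many
steps the terms `X j` vanish and a syzygy of `H` is all that is left. In this way the extensions
are added in the order that `SpanIter` requires. -/
theorem spanIter_cokernel (m : ℕ) : ∀ (n : ℕ) (X : ℕ → C) (d : ∀ j, X (j + 1) ⟶ X j)
    (w : ∀ j, d (j + 1) ≫ d j = 0) {Z H : C} (f : X 0 ⟶ Z) (wf : d 0 ≫ f = 0) (p : Z ⟶ H)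
    (wp : f ≫ p = 0), (∀ j, (ShortComplex.mk _ _ (w j)).Exact) →
    (ShortComplex.mk _ _ wf).Exact → (ShortComplex.mk _ _ wp).Exact → Epi p →
    (∀ j, D.Span P (Φ.obj (X j))) → (∀ j, m ≤ j → IsZero (X j)) →
    D.SpanIter P (n + 1) (Φ.obj Z) → D.SpanIter P (n + 1 + m) (Φ.obj H) := by
  induction m with
  | zero =>
    intro n X d w Z H f wf p wp _ _ hp _ _ hz hZ
    have := (ShortComplex.exact_iff_mono _ ((hz 0 le_rfl).eq_of_src f 0)).1 hp
    have : Mono p := this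
    have := isIso_of_mono_of_epi p
    exact TriangleData.Span.of_iso (Φ.mapIso (asIso p).symm) hZ
  | succ m ih =>
    intro n X d w Z H f wf p wp hd hf hp hp' hX hz hZ
    let π := Projective.π H
    let q : Projective.over H ⟶ Z := Projective.factorThru π p
    have hq : q ≫ p = π := Projective.factorThru_comp _ _
    let g : X 0 ⊞ Projective.over H ⟶ Z := biprod.desc f q
    have hg : Epi g := by
      rw [epi_iff_surjective_up_to_refinements]
      intro A y
      obtain ⟨A', ρ, hρ, a, ha⟩ := surjective_up_to_refinements_of_epi π (y ≫ p)
      obtain ⟨A'', ρ', hρ', b, hb⟩ := hp.exact_up_to_refinements (ρ ≫ y - a ≫ q)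
        (by simp [ha, hq])
      dsimp at b hb
      refine ⟨A'', ρ' ≫ ρ, inferInstance, biprod.lift b (ρ' ≫ a), ?_⟩
      simp only [g, biprod.lift_desc, ← hb, Preadditive.comp_sub, Category.assoc]
      abel
    let f' : X 1 ⟶ kernel g := kernel.lift g (d 0 ≫ biprod.inl) (by simp [g, wf])
    have hf' : f' ≫ kernel.ι g = d 0 ≫ biprod.inl := kernel.lift_ι _ _ _
    have hgk : kernel.ι g ≫ biprod.fst ≫ f + kernel.ι g ≫ biprod.snd ≫ q = 0 := by
      simpa [g, biprod.desc_eq] using kernel.condition g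
    let p' : kernel g ⟶ kernel π := kernel.lift π (kernel.ι g ≫ biprod.snd) (by
      have := congr($hgk ≫ p)
      simpa [wp, hq] using this)
    have hp'' : p' ≫ kernel.ι π = kernel.ι g ≫ biprod.snd := kernel.lift_ι _ _ _
    have key : D.SpanIter P (n + 1 + 1 + m) (Φ.obj (kernel π)) := by
      refine ih (n + 1) (fun j => X (j + 1)) (fun j => d (j + 1)) (fun j => w (j + 1))
        (Z := kernel g) f' ?_ p' ?_ (fun j => hd (j + 1)) ?_ ?_ ?_ (fun j => hX (j + 1))
        (fun j hj => hz (j + 1) (by omega)) ?_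
      · rw [← cancel_mono (kernel.ι g)]
        simp [hf', reassoc_of% (w 0)]
      · rw [← cancel_mono (kernel.ι π)]
        simp [hp'', reassoc_of% hf']
      · rw [ShortComplex.exact_iff_exact_up_to_refinements]
        intro A x hx
        dsimp at x hx
        refine (hd 0).exact_up_to_refinements x ?_
        have : x ≫ d 0 ≫ biprod.inl (Y := Projective.over H) = 0 := by
          rw [← hf', reassoc_of% hx, zero_comp]
        rw [← Category.assoc] at this
        exact zero_of_comp_mono _ this
      · rw [ShortComplex.exact_iff_exact_up_to_refinements]
        intro A x hx
        dsimp at x hx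
        have h2 : x ≫ kernel.ι g ≫ biprod.snd = 0 := by
          rw [← hp'', reassoc_of% hx, zero_comp]
        have h1 : (x ≫ kernel.ι g ≫ biprod.fst) ≫ f = 0 := by
          have := congr(x ≫ $hgk)
          simpa [reassoc_of% h2] using this
        obtain ⟨A', ρ, hρ, y, hy⟩ := hf.exact_up_to_refinements _ h1
        dsimp at y hy
        refine ⟨A', ρ, hρ, y, ?_⟩
        rw [← cancel_mono (kernel.ι g)]
        apply biprod.hom_ext
        · simp [hf', hy]
        · simp [hf', h2]
      · rw [epi_iff_surjective_up_to_refinements]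
        intro A y
        obtain ⟨A', ρ, hρ, a, ha⟩ := hp.exact_up_to_refinements (y ≫ kernel.ι π ≫ q)
          (by simp [hq])
        dsimp at a ha
        refine ⟨A', ρ, hρ, kernel.lift g (biprod.lift (-a) (ρ ≫ y ≫ kernel.ι π)) ?_, ?_⟩
        · simp [g, biprod.lift_desc, ← ha]
        · rw [← cancel_mono (kernel.ι π)]
          simp [hp'']
      · exact h.spanIter_left (shortExact_kernel g)
          (.biprod Φ (hX 0) (.zero (h.isZero _ inferInstance))) hZ
    have := TriangleData.Span.shift (h.isShift _ (shortExact_kernel π)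
      (by dsimp; infer_instance)) (show D.Span _ _ from (by
        rw [show n + 1 + 1 + m = (n + 1 + m) + 1 by omega] at key; exact key))
    exact this

variable {M : C}

/-- Objects with a weak resolution by `add(M)` are built from `M` in as many steps as the
resolution has terms. -/
theorem spanIter_of_hasWeakAddResolution {L : C} {n : ℕ} (hP : P (Φ.obj M))
    (hL : HasWeakAddResolution M L (n + 2)) : D.SpanIter P (n + 1) (Φ.obj L) := by
  obtain ⟨K, r, s, hrs, hadd, hlt, hgt, hex, ⟨R⟩⟩ := hL
  push_cast at hrs
  suffices D.SpanIter P (n + 1) (Φ.obj (K.homology 0)) from .summand (R.map Φ) this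
  have := Abelian.hasFiniteBiproducts (C := C)
  have hK : ∀ d, D.Span P (Φ.obj (K.X d)) := by
    intro d
    obtain ⟨m, ⟨R⟩⟩ := hadd d
    exact of_retract_biproduct (P := fun X => D.Span P (Φ.obj X))
      (fun X hX => .zero (Φ.map_isZero hX)) (fun X Y hX hY => .biprod Φ hX hY)
      (fun X Y R hY => .summand (R.map Φ) hY) (.of hP) R
  -- outside the range of the complex the cohomology vanishes
  by_cases h0 : r ≤ 0 ∧ 0 ≤ r + n
  swap
  · have : IsZero (K.X 0) := by
      by_cases h1 : 0 < r
      · exact hlt 0 h1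
      · exact hgt 0 (by omega)
    refine .zero (Φ.map_isZero ?_)
    exact ShortComplex.isZero_homology_of_isZero_X₂ _ this
  obtain ⟨hr, hr'⟩ := h0
  -- the cocycles in positive degrees
  have hcyc : ∀ (j : ℕ) (d : ℤ), 0 ≤ d → d + j = r + n →
      D.SpanIter P (j + 1) (Φ.obj (K.cycles d)) := by
    intro j
    induction j with
    | zero =>
      intro d hd hj
      have : K.d d (d + 1) = 0 := (hgt (d + 1) (by omega)).eq_of_tgt _ _
      have := K.isIso_iCycles d (d + 1) (by simp) this
      exact .of_iso (Φ.mapIso (asIso (K.iCycles d))) (h.spanIter_one (hK d))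
    | succ j ih =>
      intro d hd hj
      exact h.spanIter_left (shortExact_cycles K d (d + 1) rfl (hex _ (by omega))) (hK d)
        (ih (d + 1) (by omega) (by push_cast at hj ⊢; omega))
  obtain ⟨t, ht⟩ : ∃ t : ℕ, r + n = t := ⟨(r + n).toNat, by omega⟩
  obtain ⟨m, hm⟩ : ∃ m : ℕ, r = -m := ⟨r.natAbs, by omega⟩
  have hfin := h.spanIter_cokernel (P := P) m t (fun j => K.X (-1 - j))
    (fun j => K.d (-1 - (j + 1 : ℕ)) (-1 - j)) (fun j => K.d_comp_d _ _ _)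
    (Z := K.cycles 0) (H := K.homology 0) (K.toCycles (-1 - (0 : ℕ)) 0) (by simp)
    (K.homologyπ 0) (by simp) ?_ ?_ ?_ inferInstance (fun j => hK _)
    (fun j hj => hlt _ (by omega)) (hcyc t 0 le_rfl (by omega))
  · rwa [show n + 1 = t + 1 + m by omega]
  · intro j
    have := hex (-1 - (j + 1 : ℕ)) (by omega)
    rwa [K.exactAt_iff' (-1 - (j + 1 + 1 : ℕ)) _ (-1 - j) (by simp; omega)
      (by simp; omega)] at this
  · refine exact_toCycles K _ _ _ ?_
    have := hex (-1 - (0 : ℕ)) (by simp)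
    rwa [K.exactAt_iff' (-1 - (0 + 1 : ℕ)) (-1 - (0 : ℕ)) 0 (by simp) (by simp)] at this
  · exact ShortComplex.exact_of_g_is_cokernel _ (K.homologyIsCokernel (-1 - (0 : ℕ)) 0 (by simp))

/-- If every object of `T` can be reached from the image of an object of `C`, then the dimension
of `T` is bounded by the weak representation dimension of `C`. -/
theorem two_add_dim_le_wrepdim
    (hΦ : ∀ Y : T, ∃ L : C, ∀ Q : ObjectProperty T, D.Span Q (Φ.obj L) → D.Span Q Y) :
    2 + D.dim ≤ wrepdim C := by
  refine le_sInf ?_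
  rintro _ ⟨i, rfl, hi, M, hM⟩
  obtain ⟨n, rfl⟩ := Nat.exists_eq_add_of_le hi
  have : D.dim ≤ n := sInf_le ⟨n, rfl, Φ.obj M, fun Y => by
    obtain ⟨L, hL⟩ := hΦ Y
    refine hL _ (h.spanIter_of_hasWeakAddResolution ⟨Iso.refl _⟩ ?_)
    rw [add_comm]
    exact hM L⟩
  calc 2 + D.dim ≤ 2 + (n : ℕ∞) := by gcongr
    _ = _ := by push_cast; rfl

end IsStabilization
end Stabilization

/-! ### Resolutions by `add(M)` -/

section Resolutions

open scoped ZeroObject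

variable {C : Type u} [Category.{v} C] [Abelian C]

theorem inAdd_of_isZero {M X : C} (hX : IsZero X) : InAdd M X :=
  ⟨0, ⟨0, 0, hX.eq_of_src _ _⟩⟩

/-- Testing a property of objects on `add(M)`. -/
theorem InAdd.induct {M X : C} (hX : InAdd M X) {P : ObjectProperty C}
    (hz : ∀ X, IsZero X → P X) (hs : ∀ X Y, P X → P Y → P (X ⊞ Y))
    (hr : ∀ X Y, Retract X Y → P Y → P X) (hM : P M) : P X := by
  obtain ⟨n, ⟨R⟩⟩ := hX
  have := Abelian.hasFiniteBiproducts (C := C)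
  exact of_retract_biproduct hz hs hr hM R

/-- Maps out of `M` lift along `p`, hence so do all maps out of objects of `add(M)`. -/
theorem InAdd.lift {M N Y X : C} (hN : InAdd M N) (p : Y ⟶ X)
    (hp : ∀ f : M ⟶ X, ∃ g, g ≫ p = f) (f : N ⟶ X) : ∃ g, g ≫ p = f := by
  refine hN.induct (P := fun N => ∀ f : N ⟶ X, ∃ g, g ≫ p = f) ?_ ?_ ?_ hp f
  · exact fun N hN f => ⟨0, hN.eq_of_src _ _⟩
  · intro A B hA hB f
    obtain ⟨a, ha⟩ := hA (biprod.inl ≫ f)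
    obtain ⟨b, hb⟩ := hB (biprod.inr ≫ f)
    exact ⟨biprod.desc a b, by ext <;> simp [ha, hb]⟩
  · intro A B R hB f
    obtain ⟨b, hb⟩ := hB (R.r ≫ f)
    exact ⟨R.i ≫ b, by simp [hb]⟩

/-- Exactness of `Hom(-, M)` at `Y` implies exactness of `Hom(-, N)` at `Y` for `N` in `add(M)`. -/
theorem InAdd.extend {M N X Y Z : C} (hN : InAdd M N) (d : X ⟶ Y) (d' : Y ⟶ Z)
    (h : ∀ f : Y ⟶ M, d ≫ f = 0 → ∃ g, d' ≫ g = f) (f : Y ⟶ N) (hf : d ≫ f = 0) :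
    ∃ g, d' ≫ g = f := by
  refine hN.induct (P := fun N => ∀ f : Y ⟶ N, d ≫ f = 0 → ∃ g, d' ≫ g = f) ?_ ?_ ?_ h f hf
  · exact fun N hN f _ => ⟨0, hN.eq_of_tgt _ _⟩
  · intro A B hA hB f hf
    obtain ⟨a, ha⟩ := hA (f ≫ biprod.fst) (by simp [reassoc_of% hf])
    obtain ⟨b, hb⟩ := hB (f ≫ biprod.snd) (by simp [reassoc_of% hf])
    exact ⟨biprod.lift a b, by ext <;> simp [ha, hb]⟩
  · intro A B R hB f hf
    obtain ⟨b, hb⟩ := hB (f ≫ R.i) (by simp [reassoc_of% hf])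
    exact ⟨b ≫ R.r, by simp [reassoc_of% hb]⟩

/-- `L` has a resolution `0 → N_{t-1} → ⋯ → N_0 → L → 0` by objects of `add(M)` that stays exact
under `Hom(M, -)`. The resolution is given by the short exact sequences of which it is spliced. -/
def ResLen (M : C) : ℕ → ObjectProperty C
  | 0 => fun L => IsZero L
  | t + 1 => fun L => ∃ (K N : C) (i : K ⟶ N) (p : N ⟶ L) (w : i ≫ p = 0),
      (ShortComplex.mk i p w).ShortExact ∧ InAdd M N ∧ (∀ f : M ⟶ L, ∃ g, g ≫ p = f) ∧
      ResLen M t K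

/-- `L` has a coresolution `0 → L → N_0 → ⋯ → N_{t-1} → 0` by objects of `add(M)` that stays exact
under `Hom(-, M)`. The coresolution is given by the short exact sequences of which it is
spliced. -/
def CoresLen (M : C) : ℕ → ObjectProperty C
  | 0 => fun L => IsZero L
  | t + 1 => fun L => ∃ (K N : C) (i : L ⟶ N) (p : N ⟶ K) (w : i ≫ p = 0),
      (ShortComplex.mk i p w).ShortExact ∧ InAdd M N ∧ (∀ f : L ⟶ M, ∃ g, i ≫ g = f) ∧
      CoresLen M t K

theorem exact_comp_mono {X Y Z W : C} {f : X ⟶ Y} {g : Y ⟶ Z} {w : f ≫ g = 0}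
    (h : (ShortComplex.mk f g w).Exact) (i : Z ⟶ W) [Mono i] :
    (ShortComplex.mk f (g ≫ i) (by simp [reassoc_of% w])).Exact :=
  (ShortComplex.exact_iff_of_epi_of_isIso_of_mono (S₁ := .mk f g w)
    (S₂ := .mk f (g ≫ i) (by simp [reassoc_of% w]))
    { τ₁ := 𝟙 _, τ₂ := 𝟙 _, τ₃ := i }).1 h

theorem exact_epi_comp {X Y Z W : C} {f : X ⟶ Y} {g : Y ⟶ Z} {w : f ≫ g = 0}
    (h : (ShortComplex.mk f g w).Exact) (p : W ⟶ X) [Epi p] :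
    (ShortComplex.mk (p ≫ f) g (by simp [w])).Exact :=
  (ShortComplex.exact_iff_of_epi_of_isIso_of_mono (S₁ := .mk (p ≫ f) g (by simp [w]))
    (S₂ := .mk f g w)
    { τ₁ := p, τ₂ := 𝟙 _, τ₃ := 𝟙 _ }).2 h

/-- Splicing the short exact sequences of a resolution. The conclusions say that the augmented complex
is exact, and that it stays exact under `Hom(M, -)`. -/
theorem ResLen.exists_complex {M : C} (t : ℕ) : ∀ L : C, ResLen M t L →
    ∃ (E : ChainComplex C ℕ) (e : E.X 0 ⟶ L) (w : E.d 1 0 ≫ e = 0),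
      (∀ j, InAdd M (E.X j)) ∧ (∀ j, t ≤ j → IsZero (E.X j)) ∧
      (Epi e ∧ (ShortComplex.mk _ _ w).Exact ∧
        ∀ j, (ShortComplex.mk _ _ (E.d_comp_d (j + 2) (j + 1) j)).Exact) ∧
      (∀ f : M ⟶ L, ∃ g, g ≫ e = f) ∧
      (∀ f : M ⟶ E.X 0, f ≫ e = 0 → ∃ g, g ≫ E.d 1 0 = f) ∧
      (∀ (j : ℕ) (f : M ⟶ E.X (j + 1)), f ≫ E.d (j + 1) j = 0 →
        ∃ g, g ≫ E.d (j + 2) (j + 1) = f) := by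
  induction t with
  | zero =>
    intro L hL
    have hL' : IsZero L := hL
    have h0 : ∀ j, IsZero ((0 : ChainComplex C ℕ).X j) := fun j =>
      (HomologicalComplex.eval C _ j).map_isZero (isZero_zero _)
    exact ⟨0, 0, by simp, fun j => inAdd_of_isZero (h0 j), fun j _ => h0 j,
      ⟨⟨fun _ _ _ => hL'.eq_of_src _ _⟩, ShortComplex.exact_of_isZero_X₂ _ (h0 _),
        fun j => ShortComplex.exact_of_isZero_X₂ _ (h0 _)⟩,
      fun f => ⟨0, hL'.eq_of_tgt _ _⟩, fun f _ => ⟨0, (h0 _).eq_of_tgt _ _⟩,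
      fun j f _ => ⟨0, (h0 _).eq_of_tgt _ _⟩⟩
  | succ t ih =>
    rintro L ⟨K, N, i, p, w, hS, hN, hl, hK⟩
    obtain ⟨E, e, we, hE, hz, ⟨he, hex, hexs⟩, hl0, hl1, hl2⟩ := ih K hK
    have : Mono i := hS.mono_f
    have we' : E.d 1 0 ≫ e ≫ i = 0 := by rw [reassoc_of% we, zero_comp]
    refine ⟨E.augment (e ≫ i) we', p, show (e ≫ i) ≫ p = 0 by rw [Category.assoc, w, comp_zero],
      ?_, ?_, ⟨hS.epi_g, ?_, ?_⟩, hl, ?_, ?_⟩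
    · rintro (_ | j)
      exacts [hN, hE j]
    · rintro (_ | j) hj
      exacts [absurd hj (by simp), hz j (by omega)]
    · exact exact_epi_comp hS.exact e
    · rintro (_ | j)
      exacts [exact_comp_mono hex i, hexs j]
    · intro f hf
      obtain ⟨g, hg⟩ := hl0 (hS.exact.lift f hf)
      refine ⟨g, ?_⟩
      have : hS.exact.lift f hf ≫ i = f := hS.exact.lift_f f hf
      change g ≫ e ≫ i = f
      rw [reassoc_of% hg, this]
    · rintro (_ | j) f hf
      · refine hl1 f ?_
        rw [← cancel_mono i, zero_comp]
        exact (Category.assoc _ _ _).trans hf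
      · exact hl2 j f hf

/-- Splicing the short exact sequences of a coresolution. -/
theorem CoresLen.exists_complex {M : C} (t : ℕ) : ∀ L : C, CoresLen M t L →
    ∃ (E : CochainComplex C ℕ) (e : L ⟶ E.X 0) (w : e ≫ E.d 0 1 = 0),
      (∀ j, InAdd M (E.X j)) ∧ (∀ j, t ≤ j → IsZero (E.X j)) ∧
      (Mono e ∧ (ShortComplex.mk _ _ w).Exact ∧
        ∀ j, (ShortComplex.mk _ _ (E.d_comp_d j (j + 1) (j + 2))).Exact) ∧
      (∀ f : L ⟶ M, ∃ g, e ≫ g = f) ∧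
      (∀ f : E.X 0 ⟶ M, e ≫ f = 0 → ∃ g, E.d 0 1 ≫ g = f) ∧
      (∀ (j : ℕ) (f : E.X (j + 1) ⟶ M), E.d j (j + 1) ≫ f = 0 →
        ∃ g, E.d (j + 1) (j + 2) ≫ g = f) := by
  induction t with
  | zero =>
    intro L hL
    have hL' : IsZero L := hL
    have h0 : ∀ j, IsZero ((0 : CochainComplex C ℕ).X j) := fun j =>
      (HomologicalComplex.eval C _ j).map_isZero (isZero_zero _)
    exact ⟨0, 0, by simp, fun j => inAdd_of_isZero (h0 j), fun j _ => h0 j,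
      ⟨⟨fun _ _ _ => hL'.eq_of_tgt _ _⟩, ShortComplex.exact_of_isZero_X₂ _ (h0 _),
        fun j => ShortComplex.exact_of_isZero_X₂ _ (h0 _)⟩,
      fun f => ⟨0, hL'.eq_of_src _ _⟩, fun f _ => ⟨0, (h0 _).eq_of_src _ _⟩,
      fun j f _ => ⟨0, (h0 _).eq_of_src _ _⟩⟩
  | succ t ih =>
    rintro L ⟨K, N, i, p, w, hS, hN, hl, hK⟩
    obtain ⟨E, e, we, hE, hz, ⟨he, hex, hexs⟩, hl0, hl1, hl2⟩ := ih K hK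
    have : Epi p := hS.epi_g
    have we' : (p ≫ e) ≫ E.d 0 1 = 0 := by rw [Category.assoc, we, comp_zero]
    refine ⟨E.augment (p ≫ e) we', i, show i ≫ p ≫ e = 0 by rw [reassoc_of% w, zero_comp], ?_, ?_,
      ⟨hS.mono_f, ?_, ?_⟩, hl, ?_, ?_⟩
    · rintro (_ | j)
      exacts [hN, hE j]
    · rintro (_ | j) hj
      exacts [absurd hj (by simp), hz j (by omega)]
    · exact exact_comp_mono hS.exact e
    · rintro (_ | j)
      exacts [exact_epi_comp hex p, hexs j]
    · intro f hf
      obtain ⟨g, hg⟩ := hl0 (hS.exact.desc f hf)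
      refine ⟨g, ?_⟩
      have : p ≫ hS.exact.desc f hf = f := hS.exact.g_desc f hf
      change (p ≫ e) ≫ g = f
      rw [Category.assoc, hg, this]
    · rintro (_ | j) f hf
      · refine hl1 f ?_
        rw [← cancel_epi p, comp_zero]
        exact (Category.assoc _ _ _).symm.trans hf
      · exact hl2 j f hf

theorem acyclic_of_chain {A : Type*} [Category* A] [Abelian A] (K : ChainComplex A ℕ)
    (h0 : Epi (K.d 1 0))
    (h : ∀ j, (ShortComplex.mk _ _ (K.d_comp_d (j + 2) (j + 1) j)).Exact) : K.Acyclic := by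
  rintro (_ | j)
  · rw [K.exactAt_iff' 1 0 0 (by simp) (by simp)]
    exact (ShortComplex.exact_iff_epi _ (K.shape 0 0 (by simp))).2 h0
  · rw [K.exactAt_iff' (j + 2) (j + 1) j (by simp) (by simp)]
    exact h j

theorem acyclic_of_cochain {A : Type*} [Category* A] [Abelian A] (K : CochainComplex A ℕ)
    (h0 : Mono (K.d 0 1))
    (h : ∀ j, (ShortComplex.mk _ _ (K.d_comp_d j (j + 1) (j + 2))).Exact) : K.Acyclic := by
  rintro (_ | j)
  · rw [K.exactAt_iff' 0 0 1 (by simp) (by simp)]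
    exact (ShortComplex.exact_iff_mono _ (K.shape 0 0 (by simp))).2 h0
  · rw [K.exactAt_iff' j (j + 1) (j + 2) (by simp) (by simp)]
    exact h j

theorem ResLen.hasAddResolution {M L : C} {t : ℕ} (h : ResLen M t L) :
    HasAddResolution M L (t + 1) := by
  obtain ⟨E, e, w, hE, hz, ⟨he, hex, hexs⟩, hl0, hl1, hl2⟩ := h.exists_complex
  refine ⟨E.augment e w, ⟨Iso.refl _⟩, hE, ?_, ?_, ?_⟩
  · rintro (_ | j) hj
    exacts [absurd hj (by simp), hz j (by omega)]
  · refine acyclic_of_chain _ he ?_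
    rintro (_ | j)
    exacts [hex, hexs j]
  · refine acyclic_of_chain _ ?_ ?_
    · rw [AddCommGrpCat.epi_iff_surjective]
      exact hl0
    · rintro (_ | j)
      · exact (ShortComplex.ab_exact_iff _).2 hl1
      · exact (ShortComplex.ab_exact_iff _).2 (hl2 j)

theorem CoresLen.hasAddCoresolution {M L : C} {t : ℕ} (h : CoresLen M t L) :
    HasAddCoresolution M L (t + 1) := by
  obtain ⟨E, e, w, hE, hz, ⟨he, hex, hexs⟩, hl0, hl1, hl2⟩ := h.exists_complex
  refine ⟨E.augment e w, ⟨Iso.refl _⟩, hE, ?_, ?_, ?_⟩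
  · rintro (_ | j) hj
    exacts [absurd hj (by simp), hz j (by omega)]
  · refine acyclic_of_cochain _ he ?_
    rintro (_ | j)
    exacts [hex, hexs j]
  · refine acyclic_of_chain (((preadditiveYoneda.obj M).mapHomologicalComplex _).obj
      (E.augment e w).op) ?_ ?_
    · rw [AddCommGrpCat.epi_iff_surjective]
      exact hl0
    · rintro (_ | j)
      · exact (ShortComplex.ab_exact_iff _).2 hl1
      · exact (ShortComplex.ab_exact_iff _).2 (hl2 j)

/-- If `N 0 → N 1 → ⋯` is a complex in `add(M)` such that `Hom(-, M)` is exact at all the terms but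
`N 0`, and `X` has a resolution with `t` terms, then `Hom(-, X)` is exact at the terms `N p` with
`p ≥ t` and `p ≥ 1`: shift dimensions along the resolution. -/
theorem ResLen.exists_factor {M : C} {N : ℕ → C} {d : ∀ j, N j ⟶ N (j + 1)}
    (w : ∀ j, d j ≫ d (j + 1) = 0) (hN : ∀ j, InAdd M (N j))
    (hex : ∀ (j : ℕ) (f : N (j + 1) ⟶ M), d j ≫ f = 0 → ∃ g, d (j + 1) ≫ g = f) (t : ℕ) :
    ∀ X : C, ResLen M t X → ∀ p, t ≤ p + 1 → ∀ f : N (p + 1) ⟶ X, d p ≫ f = 0 →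
      ∃ g, d (p + 1) ≫ g = f := by
  induction t with
  | zero => exact fun X hX p _ f _ => ⟨0, IsZero.eq_of_tgt hX _ _⟩
  | succ t ih =>
    rintro X ⟨K, N₀, i, π, wπ, hS, hN₀, hl, hK⟩ p hp f hf
    have : Mono i := hS.mono_f
    obtain ⟨g, hg⟩ := (hN (p + 1)).lift π hl f
    have hgp : (d p ≫ g) ≫ π = 0 := by rw [Category.assoc, hg, hf]
    let h : N p ⟶ K := hS.exact.lift (d p ≫ g) hgp
    have hh : h ≫ i = d p ≫ g := hS.exact.lift_f _ hgp
    obtain ⟨h', hh'⟩ : ∃ h', d p ≫ h' = h := by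
      cases p with
      | zero =>
        obtain rfl : t = 0 := by omega
        exact ⟨0, IsZero.eq_of_tgt hK _ _⟩
      | succ p =>
        refine ih K hK p (by omega) h ?_
        rw [← cancel_mono i, Category.assoc, hh, reassoc_of% (w p), zero_comp, zero_comp]
    obtain ⟨k, hk⟩ := hN₀.extend (d p) (d (p + 1)) (hex p) (g - h' ≫ i)
      (by rw [Preadditive.comp_sub, reassoc_of% hh', hh, sub_self])
    exact ⟨k ≫ π, by rw [reassoc_of% hk, Preadditive.sub_comp, hg, Category.assoc, wπ,
      comp_zero, sub_zero]⟩

/-- If every object has a resolution with `t + 1` terms, then every object has a coresolution with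
`t + 1` terms. Splice the left approximations of the iterated cosyzygies of `L` to a presentation
of `L`, and apply `ResLen.exists_factor` to the cosyzygy `B t`: it turns out to be a direct summand
of its own approximation, so the coresolution can stop there. -/
theorem coresLen_of_resLen {M : C} {t : ℕ} (hres : ∀ X, ResLen M (t + 1) X)
    (hproj : ∀ X : C, ∃ (P : C) (p : P ⟶ X), InAdd M P ∧ Epi p)
    (happ : ∀ X : C, ∃ (N : C) (i : X ⟶ N), InAdd M N ∧ Mono i ∧
      ∀ f : X ⟶ M, ∃ g, i ≫ g = f) (L : C) : CoresLen M (t + 1) L := by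
  choose N l hN hl hlM using happ
  -- the iterated cosyzygies of `L`
  let B : ℕ → C := fun j => Nat.rec (motive := fun _ => C) L (fun _ X => cokernel (l X)) j
  let c : ∀ j : ℕ, N (B j) ⟶ B (j + 1) := fun j => cokernel.π (l (B j))
  have hc : ∀ j, Epi (c j) := fun j => inferInstanceAs (Epi (cokernel.π (l (B j))))
  have hlc : ∀ j, l (B j) ≫ c j = 0 := fun j => cokernel.condition (l (B j))
  have hS : ∀ j, (ShortComplex.mk _ _ (hlc j)).ShortExact := fun j =>
    { exact := ShortComplex.exact_cokernel (l (B j))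
      mono_f := hl _
      epi_g := hc j }
  obtain ⟨P₀, p, hP₀, hp⟩ := hproj L
  obtain ⟨P₁, q, hP₁, hq⟩ := hproj (kernel p)
  let N' : ℕ → C := fun j => match j with
    | 0 => P₁
    | 1 => P₀
    | j + 2 => N (B j)
  -- the term of index `j + 1` maps onto the cosyzygy of index `j`
  let e : ∀ j, N' (j + 1) ⟶ B j := fun j => match j with
    | 0 => p
    | j + 1 => c j
  have he : ∀ j, Epi (e j) := by
    rintro (_ | j)
    exacts [hp, hc j]
  let d : ∀ j, N' j ⟶ N' (j + 1) := fun j => match j with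
    | 0 => q ≫ kernel.ι p
    | j + 1 => e j ≫ l (B j)
  have w0 : (q ≫ kernel.ι p) ≫ p = 0 := by simp
  have hde : ∀ j, d j ≫ e j = 0 := by
    rintro (_ | j)
    · exact w0
    · exact (Category.assoc _ _ _).trans (by erw [hlc j]; exact comp_zero)
  have hfac : ∀ (X : C) (j : ℕ) (f : N' (j + 1) ⟶ X), d j ≫ f = 0 →
      ∃ g : B j ⟶ X, e j ≫ g = f := by
    rintro X (_ | j) f hf
    · have hf' : kernel.ι p ≫ f = 0 := by
        rw [← cancel_epi q, comp_zero]
        exact (Category.assoc _ _ _).symm.trans hf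
      exact ⟨_, (shortExact_kernel p).exact.g_desc f hf'⟩
    · have hf' : l (B j) ≫ f = 0 := by
        have := he j
        rw [← cancel_epi (e j), comp_zero]
        exact (Category.assoc _ _ _).symm.trans hf
      have := (hS j).epi_g
      exact ⟨_, (hS j).exact.g_desc f hf'⟩
  have hw : ∀ j, d j ≫ d (j + 1) = 0 := fun j => by
    change d j ≫ e j ≫ l (B j) = 0
    rw [reassoc_of% (hde j), zero_comp]
  obtain ⟨g, hg⟩ := ResLen.exists_factor (M := M) (N := N') (d := d) hw
    (by rintro (_ | _ | j); exacts [hP₁, hP₀, hN _])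
    (fun j f hf => by
      obtain ⟨g, hg⟩ := hfac _ j f hf
      obtain ⟨k, hk⟩ := hlM _ g
      exact ⟨k, by change (e j ≫ l (B j)) ≫ k = f; rw [Category.assoc, hk, hg]⟩)
    (t + 1) (B t) (hres _) t le_rfl (e t) (hde t)
  have hsplit : l (B t) ≫ g = 𝟙 (B t) := by
    have := he t
    rw [← cancel_epi (e t), Category.comp_id]
    exact (Category.assoc _ _ _).symm.trans hg
  have hBt : InAdd M (B t) := by
    obtain ⟨n, ⟨R⟩⟩ := hN (B t)
    exact ⟨n, ⟨l (B t) ≫ R.i, R.r ≫ g, by simp [hsplit]⟩⟩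
  suffices ∀ s j, j + s = t → CoresLen M (s + 1) (B j) from this t 0 (by simp)
  intro s
  induction s with
  | zero =>
    intro j hj
    obtain rfl : j = t := by omega
    exact ⟨0, B j, 𝟙 _, 0, by simp,
      { exact := (ShortComplex.exact_iff_epi _ rfl).2 (by dsimp; infer_instance)
        mono_f := by dsimp; infer_instance
        epi_g := by dsimp; infer_instance }, hBt, fun f => ⟨f, by simp⟩, isZero_zero C⟩
  | succ s ih =>
    intro j hj
    exact ⟨_, _, _, _, hlc j, hS j, hN _, hlM _, ih (j + 1) (by omega)⟩

/-- The bound for the representation dimension that comes from resolutions by `add(M)`, if `M` is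
a generator and all objects embed in their left approximations by `add(M)`. -/
theorem repdim_le {M : C} {t : ℕ} (hres : ∀ X, ResLen M (t + 1) X)
    (hproj : ∀ X : C, ∃ (P : C) (p : P ⟶ X), InAdd M P ∧ Epi p)
    (happ : ∀ X : C, ∃ (N : C) (i : X ⟶ N), InAdd M N ∧ Mono i ∧
      ∀ f : X ⟶ M, ∃ g, i ≫ g = f) : repdim C ≤ (t + 2 : ℕ) :=
  sInf_le ⟨t + 2, rfl, by omega, M, fun L => ⟨(hres L).hasAddResolution,
    (coresLen_of_resLen hres hproj happ L).hasAddCoresolution⟩⟩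

/-- Dropping the last term of an exact sequence `0 → M_{i-1} → ⋯ → M_1 → L → 0` leaves a complex
whose cohomology is `L`. -/
theorem HasAddResolution.hasWeakAddResolution {M L : C} {i : ℕ} (h : HasAddResolution M L i) :
    HasWeakAddResolution M L i := by
  obtain ⟨E, ⟨e⟩, hE, hz, hac, -⟩ := h
  let F := ChainComplex.truncate.obj E
  have hF : ∀ d : ℤ, (∃ j : ℕ, ComplexShape.embeddingDownNat.f j = d) ∨
      IsZero ((F.extend ComplexShape.embeddingDownNat).X d) := by
    intro d
    by_cases hd : ∃ j : ℕ, ComplexShape.embeddingDownNat.f j = d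
    · exact .inl hd
    · exact .inr (F.isZero_extend_X _ _ (by simpa using hd))
  refine ⟨F.extend ComplexShape.embeddingDownNat, 2 - i, 0, by omega, ?_, ?_, ?_, ?_, ?_⟩
  · intro d
    obtain ⟨j, hj⟩ | hd := hF d
    · obtain ⟨n, ⟨R⟩⟩ := hE j
      exact ⟨n, ⟨(Retract.ofIso (F.extendXIso _ hj)).trans R⟩⟩
    · exact inAdd_of_isZero hd
  · intro d hd
    obtain ⟨j, hj⟩ | hd := hF d
    · refine (hz (j + 1) ?_).of_iso (F.extendXIso _ hj)
      simp at hj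
      omega
    · exact hd
  · intro d hd
    obtain ⟨j, hj⟩ | hd := hF d
    · simp at hj
      omega
    · exact hd
  · intro d hd
    by_cases h : ∃ j : ℕ, ComplexShape.embeddingDownNat.f j = d
    · obtain ⟨j, hj⟩ := h
      obtain ⟨k, rfl⟩ : ∃ k, j = k + 1 := ⟨j - 1, by simp at hj; omega⟩
      rw [F.extend_exactAt_iff _ hj, F.exactAt_iff' (k + 2) (k + 1) k (by simp) (by simp)]
      have := hac (k + 2)
      rwa [E.exactAt_iff' (k + 3) (k + 2) (k + 1) (by simp) (by simp)] at this
    · exact F.extend_exactAt _ _ (by simpa using h)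
  · have h0 := hac 0
    rw [E.exactAt_iff' 1 0 0 (by simp) (by simp)] at h0
    have h0' : Epi (E.d 1 0) := (ShortComplex.exact_iff_epi _ (E.shape 0 0 (by simp))).1 h0
    have h1 := hac 1
    rw [E.exactAt_iff' 2 1 0 (by simp) (by simp)] at h1
    have : Epi (E.sc' 2 1 0).g := h0'
    let H := ShortComplex.RightHomologyData.ofIsColimitCokernelCofork (F.sc' 1 0 0)
      (F.shape 0 0 (by simp)) _ h1.gIsCokernel
    exact ⟨Retract.ofIso (e.symm ≪≫ H.homologyIso.symm ≪≫
      (F.homologyIsoSc' 1 0 0 (by simp) (by simp)).symm ≪≫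
      (F.extendHomologyIso ComplexShape.embeddingDownNat (j := 0) (j' := 0) (by simp)).symm)⟩

variable (C) in
theorem wrepdim_le_repdim : wrepdim C ≤ repdim C := by
  refine le_sInf ?_
  rintro _ ⟨i, rfl, hi, M, hM⟩
  exact sInf_le ⟨i, rfl, hi, M, fun L => (hM L).1.hasWeakAddResolution⟩

end Resolutions

/-! ### Modules over Artinian rings -/

section Artinian

variable {A : Type u} [Ring A] [IsArtinianRing A]

theorem isSemisimpleModule_of_jacobson_smul_eq_zero {L : Type*} [AddCommGroup L] [Module A L]
    (h : ∀ a ∈ Ring.jacobson A, ∀ x : L, a • x = 0) : IsSemisimpleModule A L := by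
  have hL : Module.IsTorsionBySet A L (Ring.jacobson A) := fun x a => h a a.2 x
  let _ := hL.module
  exact hL.isSemisimpleModule_iff.1 inferInstance

/-- A superfluous submodule is contained in the radical. -/
theorem le_jacobson_smul_top {Y : Type*} [AddCommGroup Y] [Module A Y] {W : Submodule A Y}
    (h : ∀ V, W ⊔ V = ⊤ → V = ⊤) : W ≤ Ring.jacobson A • (⊤ : Submodule A Y) := by
  set R : Submodule A Y := Ring.jacobson A • ⊤
  have : IsSemisimpleModule A (Y ⧸ R) := by
    refine isSemisimpleModule_of_jacobson_smul_eq_zero fun a ha x => ?_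
    obtain ⟨y, rfl⟩ := R.mkQ_surjective x
    rw [← map_smul, Submodule.mkQ_apply, Submodule.Quotient.mk_eq_zero]
    exact Submodule.smul_mem_smul ha trivial
  obtain ⟨C, hC⟩ := exists_isCompl (W.map R.mkQ)
  have hV : C.comap R.mkQ = ⊤ := by
    refine h _ (eq_top_iff.2 fun y _ => ?_)
    obtain ⟨w, hw, c, hc, hwc⟩ := Submodule.mem_sup.1
      (hC.sup_eq_top.ge (Submodule.mem_top (x := R.mkQ y)))
    obtain ⟨w, hw, rfl⟩ := hw
    refine Submodule.mem_sup.2 ⟨w, hw, y - w, ?_, by abel⟩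
    rw [Submodule.mem_comap, map_sub, ← hwc]
    simpa using hc
  have hC' : C = ⊤ := by
    rw [← Submodule.map_comap_eq_of_surjective R.mkQ_surjective C, hV, Submodule.map_top,
      Submodule.range_mkQ]
  have : W.map R.mkQ = ⊥ := by simpa [hC'] using hC.inf_eq_bot
  intro w hw
  have hw' : R.mkQ w ∈ W.map R.mkQ := ⟨w, hw, rfl⟩
  rw [this, Submodule.mem_bot] at hw'
  simpa using hw'

/-- Projective covers exist: a minimal submodule of a free module that still maps onto `T` is
projective. -/
theorem exists_projective_cover (T : Type*) [AddCommGroup T] [Module A T] [Module.Finite A T] :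
    ∃ (Y : Type u) (_ : AddCommGroup Y) (_ : Module A Y), Module.Finite A Y ∧
      Module.Projective A Y ∧ ∃ f : Y →ₗ[A] T, Function.Surjective f ∧
        LinearMap.ker f ≤ Ring.jacobson A • (⊤ : Submodule A Y) := by
  obtain ⟨n, π, hπ⟩ := Module.Finite.exists_fin' A T
  obtain ⟨Y, hY, hmin⟩ := IsArtinian.set_has_minimal
    {Y : Submodule A (Fin n → A) | Y ⊔ LinearMap.ker π = ⊤} ⟨⊤, top_sup_eq _⟩
  have hY' : Y ⊔ LinearMap.ker π = ⊤ := hY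
  let f : Y →ₗ[A] T := π ∘ₗ Y.subtype
  have hf : Function.Surjective f := by
    intro t
    obtain ⟨x, rfl⟩ := hπ t
    obtain ⟨y, hy, z, hz, rfl⟩ := Submodule.mem_sup.1 (hY'.ge (Submodule.mem_top (x := x)))
    have hz' : π z = 0 := hz
    exact ⟨⟨y, hy⟩, by simp [f, hz']⟩
  have hker : ∀ V : Submodule A Y, LinearMap.ker f ⊔ V = ⊤ → V = ⊤ := by
    intro V hV
    by_contra hne
    have hlt : V.map Y.subtype < Y := by
      refine lt_of_le_of_ne (Submodule.map_subtype_le _ _) fun h => hne ?_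
      refine Submodule.map_injective_of_injective Y.injective_subtype ?_
      rw [h, Submodule.map_top, Submodule.range_subtype]
    refine hmin _ ?_ hlt
    refine eq_top_iff.2 fun x _ => ?_
    obtain ⟨y, hy, z, hz, rfl⟩ := Submodule.mem_sup.1 (hY'.ge (Submodule.mem_top (x := x)))
    obtain ⟨k, hk, v, hv, hkv⟩ := Submodule.mem_sup.1
      (hV.ge (Submodule.mem_top (x := (⟨y, hy⟩ : Y))))
    have hkv' : (k : Fin n → A) + v = y := congrArg Subtype.val hkv
    refine Submodule.mem_sup.2 ⟨v, ⟨v, hv, rfl⟩, k + z, ?_, by rw [← hkv']; abel⟩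
    exact add_mem (show π k = 0 from hk) hz
  refine ⟨Y, inferInstance, inferInstance, inferInstance, ?_, f, hf, le_jacobson_smul_top hker⟩
  obtain ⟨g, hg⟩ := Module.projective_lifting_property f π hf
  have hg' : ∀ x, f (g x) = π x := fun x => LinearMap.congr_fun hg x
  have hsurj : Function.Surjective (g ∘ₗ Y.subtype) := by
    rw [← LinearMap.range_eq_top]
    refine hker _ (eq_top_iff.2 fun y _ => ?_)
    refine Submodule.mem_sup.2 ⟨y - g y, ?_, g y, ⟨y, rfl⟩, by abel⟩
    rw [LinearMap.mem_ker, map_sub, hg']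
    exact sub_self _
  let e := LinearEquiv.ofBijective (g ∘ₗ Y.subtype)
    ⟨IsNoetherian.injective_of_surjective_endomorphism _ hsurj, hsurj⟩
  refine Module.Projective.of_split (M := Fin n → A) Y.subtype (e.symm.toLinearMap ∘ₗ g) ?_
  ext1 y
  exact e.symm_apply_apply y

end Artinian

/-! ### Modules over self-injective rings -/

section SelfInjective

variable {A : Type u} [Ring A]

/-- If a finitely generated module `Y` has a surjection onto a simple module whose kernel is contained
in the radical, then `Y` is local: all proper submodules are contained in that kernel. -/
theorem le_ker_of_ne_top {Y S : Type*} [AddCommGroup Y] [Module A Y] [Module.Finite A Y]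
    [AddCommGroup S] [Module A S] [IsSimpleModule A S] {f : Y →ₗ[A] S}
    (hf : Function.Surjective f) (hk : LinearMap.ker f ≤ Ring.jacobson A • (⊤ : Submodule A Y))
    {V : Submodule A Y} (hV : V ≠ ⊤) : V ≤ LinearMap.ker f := by
  have hcoatom : IsCoatom (LinearMap.ker f) := by
    have := (f.quotKerEquivOfSurjective hf).isSimpleModule_iff.2 inferInstance
    exact isSimpleModule_iff_isCoatom.1 this
  by_contra h
  have hsup : LinearMap.ker f ⊔ V = ⊤ := hcoatom.2 _ (lt_of_le_of_ne le_sup_left fun h' =>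
    h (sup_eq_left.1 h'.symm))
  -- Nakayama's lemma for `Y ⧸ V`
  have hQ : (⊤ : Submodule A (Y ⧸ V)) ≤ Ring.jacobson A • ⊤ := by
    rintro x -
    obtain ⟨y, rfl⟩ := V.mkQ_surjective x
    obtain ⟨a, ha, b, hb, rfl⟩ := Submodule.mem_sup.1 (hsup.ge (Submodule.mem_top (x := y)))
    have hb' : V.mkQ b = 0 := by simpa using hb
    rw [map_add, hb', add_zero]
    have := Submodule.mem_map_of_mem (f := V.mkQ) (hk ha)
    rw [Submodule.map_smul''] at this
    exact Submodule.smul_mono le_rfl le_top this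
  have := (Module.Finite.fg_top (R := A) (M := Y ⧸ V)).eq_bot_of_le_jacobson_smul hQ
  have hsub : Subsingleton (Y ⧸ V) := by
    rwa [← Submodule.subsingleton_iff A, ← subsingleton_iff_bot_eq_top, eq_comm]
  exact hV (Submodule.Quotient.subsingleton_iff.1 hsub)

/-- Over a self-injective ring, finitely generated projective modules are injective. -/
theorem injective_of_projective (hA : Module.Injective A A) (Q : Type u) [AddCommGroup Q]
    [Module A Q] [Module.Finite A Q] [Module.Projective A Q] : Module.Injective A Q := by
  obtain ⟨n, π, hπ⟩ := Module.Finite.exists_fin' A Q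
  obtain ⟨s, hs⟩ := Module.projective_lifting_property π LinearMap.id hπ
  refine ⟨fun X Y _ _ _ _ f hf g => ?_⟩
  choose h hh using fun i : Fin n => hA.out f hf (LinearMap.proj i ∘ₗ s ∘ₗ g)
  refine ⟨π ∘ₗ LinearMap.pi h, fun x => ?_⟩
  have : LinearMap.pi h (f x) = s (g x) := by
    ext i
    exact hh i x
  rw [LinearMap.comp_apply, this]
  exact LinearMap.congr_fun hs (g x)

variable [IsArtinianRing A]

/-- Over a self-injective ring, the projective covers of two simple modules have isomorphic simple
submodules only if the simple modules are isomorphic. -/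
theorem nonempty_equiv_of_simple_submodule (hA : Module.Injective A A)
    {Y Y' S S' : Type u} [AddCommGroup Y] [Module A Y] [Module.Finite A Y]
    [Module.Projective A Y] [AddCommGroup Y'] [Module A Y'] [Module.Finite A Y']
    [Module.Projective A Y'] [AddCommGroup S] [Module A S] [IsSimpleModule A S]
    [AddCommGroup S'] [Module A S'] [IsSimpleModule A S'] (f : Y →ₗ[A] S) (f' : Y' →ₗ[A] S')
    (hf : Function.Surjective f) (hf' : Function.Surjective f')
    (hk : LinearMap.ker f ≤ Ring.jacobson A • (⊤ : Submodule A Y))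
    (hk' : LinearMap.ker f' ≤ Ring.jacobson A • (⊤ : Submodule A Y'))
    {X : Submodule A Y} {X' : Submodule A Y'} (hX : X ≠ ⊥) (e : X ≃ₗ[A] X') :
    Nonempty (S ≃ₗ[A] S') := by
  have hY := injective_of_projective hA Y
  have hY' := injective_of_projective hA Y'
  obtain ⟨h, hh⟩ := hY'.out X.subtype X.injective_subtype (X'.subtype ∘ₗ e.toLinearMap)
  obtain ⟨h', hh'⟩ := hY.out X'.subtype X'.injective_subtype (X.subtype ∘ₗ e.symm.toLinearMap)
  have hid : ∀ x ∈ X, h' (h x) = x := by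
    intro x hx
    have h1 : h x = e ⟨x, hx⟩ := hh ⟨x, hx⟩
    have h2 := hh' (e ⟨x, hx⟩)
    rw [h1]
    simpa using h2
  -- if `h' ∘ h` were not surjective, then it would be nilpotent
  have hsurj : Function.Surjective (h' ∘ₗ h) := by
    rw [← LinearMap.range_eq_top]
    by_contra hne
    have hle := (le_ker_of_ne_top hf hk hne).trans hk
    obtain ⟨N, hN⟩ := IsSemiprimaryRing.isNilpotent (R := A)
    have hpow : ∀ n : ℕ, X ≤ Ring.jacobson A ^ n • (⊤ : Submodule A Y) := by
      intro n
      induction n with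
      | zero => rw [Submodule.pow_zero, Ideal.one_eq_top, Submodule.top_smul]; exact le_top
      | succ n ih =>
        intro x hx
        have := Submodule.mem_map_of_mem (f := h' ∘ₗ h) (ih hx)
        rw [Submodule.map_smul'', Submodule.map_top, LinearMap.comp_apply, hid x hx] at this
        rw [Submodule.pow_succ, Submodule.mul_smul]
        exact Submodule.smul_mono le_rfl hle this
    refine hX (eq_bot_iff.2 ((hpow N).trans ?_))
    rw [hN]
    simp
  let g : Y' →ₗ[A] S := f ∘ₗ h'
  have hg : Function.Surjective g := by
    refine hf.comp ?_
    intro y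
    obtain ⟨z, hz⟩ := hsurj y
    exact ⟨h z, hz⟩
  have hcoatom : ∀ {Z : Type u} [AddCommGroup Z] [Module A Z] [IsSimpleModule A Z]
      (f : Y' →ₗ[A] Z), Function.Surjective f → IsCoatom (LinearMap.ker f) := by
    intro Z _ _ _ f hf
    have := (f.quotKerEquivOfSurjective hf).isSimpleModule_iff.2 inferInstance
    exact isSimpleModule_iff_isCoatom.1 this
  have hle := le_ker_of_ne_top hf' hk' (hcoatom g hg).1
  have heq : LinearMap.ker g = LinearMap.ker f' := by
    by_contra hne
    exact (hcoatom f' hf').1 ((hcoatom g hg).2 _ (lt_of_le_of_ne hle hne))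
  exact ⟨(g.quotKerEquivOfSurjective hg).symm ≪≫ₗ Submodule.quotEquivOfEq _ _ heq ≪≫ₗ
    f'.quotKerEquivOfSurjective hf'⟩

/-- There are only finitely many simple modules over an Artinian ring, so any sequence of simple
modules contains two isomorphic ones. -/
theorem exists_equiv_of_sequence (m : ℕ → Ideal A) (hm : ∀ i, (m i).IsMaximal) :
    ∃ i j, i < j ∧ Nonempty ((A ⧸ m i) ≃ₗ[A] (A ⧸ m j)) := by
  let R := A ⧸ Ring.jacobson A
  have : IsSemisimpleModule A R := by
    refine isSemisimpleModule_of_jacobson_smul_eq_zero fun a ha x => ?_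
    obtain ⟨y, rfl⟩ := (Ring.jacobson A).mkQ_surjective x
    rw [← map_smul, Submodule.mkQ_apply, Submodule.Quotient.mk_eq_zero]
    exact Ideal.mul_mem_right _ _ ha
  have hsimple : ∀ i, IsSimpleModule A (A ⧸ m i) := fun i =>
    isSimpleModule_iff_isCoatom.2 (hm i).out
  -- the simple module `A ⧸ m i` as a submodule of `A ⧸ J`
  have hS : ∀ i, ∃ S : Submodule A R, Nonempty ((A ⧸ m i) ≃ₗ[A] S) := by
    intro i
    have hle : Ring.jacobson A ≤ m i := Ring.jacobson_le_of_isMaximal _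
    let π : R →ₗ[A] (A ⧸ m i) := Submodule.factor hle
    have hπ : Function.Surjective π := Submodule.factor_surjective hle
    obtain ⟨C, hC⟩ := exists_isCompl (LinearMap.ker π)
    exact ⟨C, ⟨(π.quotKerEquivOfSurjective hπ).symm ≪≫ₗ Submodule.quotientEquivOfIsCompl _ _ hC⟩⟩
  choose S hS using hS
  have hS' : ∀ i, IsSimpleModule A (S i) := fun i => (hS i).some.isSimpleModule_iff.1 (hsimple i)
  let F : ℕ → isotypicComponents A R := fun i => ⟨isotypicComponent A R (S i), S i, hS' i, rfl⟩
  obtain ⟨i, j, hij, hF⟩ := Finite.exists_ne_map_eq_of_infinite F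
  have hF' : isotypicComponent A R (S i) = isotypicComponent A R (S j) := congrArg Subtype.val hF
  have key : Nonempty (S i ≃ₗ[A] S j) := by
    have hle : S i ≤ isotypicComponent A R (S j) := hF' ▸ Submodule.le_isotypicComponent (S i)
    have := IsIsotypicOfType.isotypicComponent A R (S j)
    rw [isIsotypicOfType_submodule_iff] at this
    exact this (S i) hle
  have e : (A ⧸ m i) ≃ₗ[A] (A ⧸ m j) := (hS i).some ≪≫ₗ key.some ≪≫ₗ (hS j).some.symm
  rcases lt_or_gt_of_ne hij with h | h
  exacts [⟨i, j, h, ⟨e⟩⟩, ⟨j, i, h, ⟨e.symm⟩⟩]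

/-- Every simple module over a self-injective Artinian ring embeds in the ring. Iterate
`S ↦ a simple submodule of the projective cover of S`: this is injective on isomorphism classes,
hence, by finiteness, `S` is isomorphic to one of its iterates, a submodule of a projective module. -/
theorem exists_projective_embedding (hA : Module.Injective A A) (S : Ideal A) [hS : S.IsMaximal] :
    ∃ g : (A ⧸ S) →ₗ[A] A, g ≠ 0 := by
  have hsimple : ∀ m : {m : Ideal A // m.IsMaximal}, IsSimpleModule A (A ⧸ m.1) := fun m =>
    isSimpleModule_iff_isCoatom.2 m.2.out
  choose Y i₁ i₂ hfin hproj f hf hk using fun m : {m : Ideal A // m.IsMaximal} =>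
    exists_projective_cover (A := A) (A ⧸ m.1)
  have hX : ∀ m, ∃ X : Submodule A (Y m), IsSimpleModule A X := by
    intro m
    have : Nontrivial (Y m) := by
      have := IsSimpleModule.nontrivial A (A ⧸ m.1)
      exact (hf m).nontrivial
    obtain ⟨X, hX⟩ := IsAtomic.exists_atom (Submodule A (Y m))
    exact ⟨X, isSimpleModule_iff_isAtom.2 hX⟩
  choose X hX using hX
  have hα : ∀ m, ∃ m' : {m : Ideal A // m.IsMaximal}, Nonempty (X m ≃ₗ[A] (A ⧸ m'.1)) := by
    intro m
    obtain ⟨I, hI, e⟩ := isSimpleModule_iff_quot_maximal.1 (hX m)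
    exact ⟨⟨I, hI⟩, e⟩
  choose α hα using hα
  have hinj : ∀ m m', Nonempty ((A ⧸ (α m).1) ≃ₗ[A] (A ⧸ (α m').1)) →
      Nonempty ((A ⧸ m.1) ≃ₗ[A] (A ⧸ m'.1)) := by
    rintro m m' ⟨e⟩
    have := IsSimpleModule.nontrivial A (X m)
    exact nonempty_equiv_of_simple_submodule hA (f m) (f m') (hf m) (hf m') (hk m) (hk m')
      (X := X m) (X' := X m') (Submodule.nontrivial_iff_ne_bot.1 this)
      ((hα m).some ≪≫ₗ e ≪≫ₗ (hα m').some.symm)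
  have hback : ∀ i p, Nonempty ((A ⧸ (α^[i] ⟨S, hS⟩).1) ≃ₗ[A] (A ⧸ (α^[i + p] ⟨S, hS⟩).1)) →
      Nonempty ((A ⧸ S) ≃ₗ[A] (A ⧸ (α^[p] ⟨S, hS⟩).1)) := by
    intro i p
    induction i with
    | zero => rw [Nat.zero_add]; exact id
    | succ i ih =>
      intro h
      refine ih (hinj _ _ ?_)
      rwa [← Function.iterate_succ_apply' α, ← Function.iterate_succ_apply' α,
        show (i + p).succ = i + 1 + p by omega]
  obtain ⟨i, j, hij, he⟩ := exists_equiv_of_sequence (fun i => (α^[i] ⟨S, hS⟩).1)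
    (fun i => (α^[i] ⟨S, hS⟩).2)
  obtain ⟨p, rfl⟩ : ∃ p, j = i + (p + 1) := ⟨j - i - 1, by omega⟩
  obtain ⟨e⟩ := hback i (p + 1) he
  rw [Function.iterate_succ_apply'] at e
  have hsimple' : IsSimpleModule A (A ⧸ S) := hsimple ⟨S, hS⟩
  have := IsSimpleModule.nontrivial A (A ⧸ S)
  set m := α^[p] ⟨S, hS⟩
  let g : (A ⧸ S) →ₗ[A] Y m := (X m).subtype ∘ₗ (e ≪≫ₗ (hα m).some.symm).toLinearMap
  have hg : Function.Injective g :=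
    (X m).injective_subtype.comp (e ≪≫ₗ (hα m).some.symm).injective
  obtain ⟨y, hy⟩ := exists_ne (0 : A ⧸ S)
  obtain ⟨d, hd⟩ := Module.Projective.exists_dual_ne_zero A
    (show g y ≠ 0 from fun h => hy (hg (h.trans (map_zero g).symm)))
  exact ⟨d ∘ₗ g, fun h => hd (LinearMap.congr_fun h y)⟩

/-- A self-injective Artinian ring is a cogenerator. -/
theorem exists_ne_zero_of_ne_zero (hA : Module.Injective A A) {X : Type u} [AddCommGroup X]
    [Module A X] {x : X} (hx : x ≠ 0) : ∃ g : X →ₗ[A] A, g x ≠ 0 := by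
  let I : Ideal A := LinearMap.ker (LinearMap.toSpanSingleton A X x)
  have hI : I ≠ ⊤ := by
    intro h
    have : (1 : A) ∈ I := h ▸ Submodule.mem_top
    exact hx (by simpa [I] using this)
  obtain ⟨S, hS, hIS⟩ := Ideal.exists_le_maximal I hI
  obtain ⟨g, hg⟩ := exists_projective_embedding hA S
  have hg1 : g (Submodule.Quotient.mk 1) ≠ 0 := by
    intro h
    refine hg (LinearMap.ext fun y => ?_)
    obtain ⟨a, rfl⟩ := Submodule.Quotient.mk_surjective _ y
    have : (Submodule.Quotient.mk a : A ⧸ S) = a • Submodule.Quotient.mk 1 := by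
      rw [← Submodule.Quotient.mk_smul, smul_eq_mul, mul_one]
    rw [this, map_smul, h, smul_zero, LinearMap.zero_apply]
  obtain ⟨h, hh⟩ := hA.out (I.liftQ (LinearMap.toSpanSingleton A X x) le_rfl)
    (LinearMap.ker_eq_bot.1 (Submodule.ker_liftQ_eq_bot _ _ _ le_rfl))
    (g ∘ₗ Submodule.factor hIS)
  refine ⟨h, ?_⟩
  have := hh (Submodule.Quotient.mk 1)
  simp only [Submodule.liftQ_apply, LinearMap.toSpanSingleton_apply, one_smul] at this
  rw [this]
  exact hg1

end SelfInjective

/-! ### Splitting off projective summands -/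

section SplitProjective

variable {A : Type u} [Ring A] [IsArtinianRing A]

/-- Over a self-injective ring, a left ideal that is maximal among the left ideals disjoint from a
left ideal `I` is projective: injectivity makes it the kernel of an endomorphism of `A` that is the
identity on `I`, and the Fitting decomposition then makes it a direct summand. -/
theorem projective_of_maximal_disjoint (hA : Module.Injective A A) {I F : Ideal A}
    (hFI : Disjoint F I) (hmax : ∀ G, F ≤ G → Disjoint G I → G = F) : Module.Projective A F := by
  -- extend the inclusion of `I` to `A ⧸ F`
  let ι : I →ₗ[A] (A ⧸ F) := F.mkQ ∘ₗ I.subtype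
  have hι : Function.Injective ι := by
    rw [← LinearMap.ker_eq_bot, LinearMap.ker_eq_bot']
    intro i hi
    have : (i : A) ∈ F := by simpa [ι] using hi
    exact Subtype.ext (Submodule.disjoint_def.1 hFI _ this i.2)
  obtain ⟨ψ, hψ⟩ := hA.out ι hι I.subtype
  let φ : Module.End A A := ψ ∘ₗ F.mkQ
  have hφI : ∀ i ∈ I, φ i = i := fun i hi => hψ ⟨i, hi⟩
  have hFφ : ∀ x ∈ F, φ x = 0 := fun x hx => by
    have : F.mkQ x = 0 := by simpa using hx
    simp [φ, this]
  -- the preimage of a submodule that is disjoint from `I` is `F`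
  have hpre : ∀ N : Ideal A, Disjoint N I → Submodule.comap φ N = F := by
    intro N hN
    refine hmax _ (fun x hx => ?_) ?_
    · rw [Submodule.mem_comap, hFφ x hx]
      exact N.zero_mem
    · rw [Submodule.disjoint_def]
      intro x hx hxI
      rw [Submodule.mem_comap, hφI x hxI] at hx
      exact Submodule.disjoint_def.1 hN x hx hxI
  have hker : LinearMap.ker φ = F := hpre ⊥ disjoint_bot_left
  have hker2 : ∀ x, φ (φ x) = 0 → φ x = 0 := by
    intro x hx
    have h1 : x ∈ Submodule.comap φ F := by
      rw [Submodule.mem_comap, ← hker]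
      exact hx
    rw [hpre F hFI, ← hker] at h1
    exact h1
  have hkerpow : ∀ n : ℕ, LinearMap.ker (φ ^ (n + 1)) = F := by
    intro n
    induction n with
    | zero => simpa using hker
    | succ n ih =>
      refine le_antisymm (fun x hx => ?_) (fun x hx => ?_)
      · rw [← ih, LinearMap.mem_ker]
        rw [LinearMap.mem_ker, pow_succ', pow_succ', Module.End.mul_apply,
          Module.End.mul_apply] at hx
        rw [pow_succ', Module.End.mul_apply]
        exact hker2 _ hx
      · rw [LinearMap.mem_ker, pow_succ, Module.End.mul_apply, hFφ x hx, map_zero]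
  obtain ⟨n, hn⟩ := φ.eventually_isCompl_ker_pow_range_pow.exists_forall_of_atTop
  have hc := hn (n + 1) (Nat.le_succ n)
  rw [hkerpow n] at hc
  refine Module.Projective.of_split F.subtype (Submodule.projectionOnto _ _ hc) ?_
  ext1 x
  exact Submodule.projectionOnto_apply_left hc x

/-- If `J ^ n` does not kill `x`, where `J ^ (n + 1) = 0`, then some nonzero projective left ideal
embeds into `L` by `a ↦ a • x`: take a maximal left ideal disjoint from the annihilator of `x`. It
is nonzero because otherwise the annihilator would contain the semisimple left ideal `J ^ n`. -/
theorem exists_projective_submodule (hA : Module.Injective A A) {n : ℕ}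
    (hn : Ring.jacobson A ^ (n + 1) = ⊥) {L : Type*} [AddCommGroup L] [Module A L] {x : L} {a : A}
    (ha : a ∈ Ring.jacobson A ^ n) (hax : a • x ≠ 0) :
    ∃ F : Submodule A L, F ≠ ⊥ ∧ Module.Projective A F ∧ Module.Finite A F := by
  let I : Ideal A := LinearMap.ker (LinearMap.toSpanSingleton A L x)
  obtain ⟨F, hF, hmax⟩ := set_has_maximal_iff_noetherian.2 (inferInstance : IsNoetherian A A)
    {F : Ideal A | Disjoint F I} ⟨⊥, disjoint_bot_left⟩
  have hmax' : ∀ G, F ≤ G → Disjoint G I → G = F := fun G hFG hG => by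
    by_contra hne
    exact hmax G hG (lt_of_le_of_ne hFG (Ne.symm hne))
  have hproj := projective_of_maximal_disjoint hA hF hmax'
  let p : F →ₗ[A] L := LinearMap.toSpanSingleton A L x ∘ₗ F.subtype
  have hp : Function.Injective p := by
    rw [← LinearMap.ker_eq_bot, LinearMap.ker_eq_bot']
    intro f hf
    exact Subtype.ext (Submodule.disjoint_def.1 hF _ f.2 hf)
  let e : F ≃ₗ[A] LinearMap.range p := LinearEquiv.ofInjective p hp
  refine ⟨LinearMap.range p, ?_, Module.Projective.of_equiv e, inferInstance⟩
  intro hbot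
  have hF0 : F = ⊥ := by
    have : p = 0 := LinearMap.range_eq_bot.1 hbot
    refine (Submodule.eq_bot_iff _).2 fun f hf => ?_
    have h1 : p ⟨f, hf⟩ = p 0 := by rw [this]; rfl
    exact congrArg Subtype.val (hp h1)
  -- now `I` meets all nonzero left ideals, so it contains the semisimple left ideal `J ^ n`
  let S : Ideal A := Ring.jacobson A ^ n
  have hS : IsSemisimpleModule A S := by
    refine isSemisimpleModule_of_jacobson_smul_eq_zero fun b hb s => Subtype.ext ?_
    have : b * (s : A) ∈ Ring.jacobson A ^ (n + 1) := by
      rw [Ideal.IsTwoSided.pow_succ]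
      exact Ideal.mul_mem_mul hb s.2
    rw [hn] at this
    exact this
  obtain ⟨C, hC⟩ := exists_isCompl (Submodule.comap S.subtype I)
  have hCI : Disjoint (C.map S.subtype) I := by
    rw [Submodule.disjoint_def]
    rintro _ ⟨c, hc, rfl⟩ hcI
    rw [Submodule.disjoint_def.1 hC.disjoint c hcI hc, map_zero]
  have hC0 : C.map S.subtype = ⊥ := by
    rw [← hF0]
    exact hmax' _ (hF0 ▸ bot_le) hCI
  have hC0' : C = ⊥ :=
    Submodule.map_injective_of_injective S.injective_subtype (by rw [hC0, Submodule.map_bot])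
  have htop : Submodule.comap S.subtype I = ⊤ := by simpa [hC0'] using hC.sup_eq_top
  have : (⟨a, ha⟩ : S) ∈ Submodule.comap S.subtype I := htop ▸ Submodule.mem_top
  exact hax this

/-- Over a self-injective ring of Loewy length at most `n + 1`, every finitely generated module is
the direct sum of a projective module and of a module of Loewy length at most `n`: split off a
maximal projective submodule. -/
theorem exists_isCompl_projective (hA : Module.Injective A A) {n : ℕ}
    (hn : Ring.jacobson A ^ (n + 1) = ⊥) (L : Type u) [AddCommGroup L] [Module A L]
    [Module.Finite A L] :
    ∃ Q L' : Submodule A L, IsCompl Q L' ∧ Module.Projective A Q ∧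
      ∀ a ∈ Ring.jacobson A ^ n, ∀ x ∈ L', a • x = 0 := by
  obtain ⟨Q, hQ, hmax⟩ := set_has_maximal_iff_noetherian.2 (inferInstance : IsNoetherian A L)
    {Q : Submodule A L | Module.Projective A Q}
    ⟨⊥, inferInstanceAs (Module.Projective A (⊥ : Submodule A L))⟩
  have hQ' : Module.Projective A Q := hQ
  have hinj := injective_of_projective hA Q
  obtain ⟨π, hπ⟩ := hinj.out Q.subtype Q.injective_subtype LinearMap.id
  refine ⟨Q, LinearMap.ker π, LinearMap.isCompl_of_proj hπ, hQ', ?_⟩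
  intro a ha x hx
  by_contra hax
  obtain ⟨F, hF, hFp, hFf⟩ := exists_projective_submodule hA hn (L := LinearMap.ker π) (x := ⟨x, hx⟩)
    ha (fun h => hax (congrArg Subtype.val h))
  let G : Submodule A L := F.map (LinearMap.ker π).subtype
  let eG : F ≃ₗ[A] G := Submodule.equivMapOfInjective _ (LinearMap.ker π).injective_subtype F
  have hGp : Module.Projective A G := Module.Projective.of_equiv eG
  have hG : G ≠ ⊥ := fun h =>
    hF (Submodule.map_injective_of_injective (LinearMap.ker π).injective_subtype
      (by rw [Submodule.map_bot]; exact h))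
  have hGk : G ≤ LinearMap.ker π := Submodule.map_subtype_le _ _
  have hdisj : Disjoint Q G := (LinearMap.isCompl_of_proj hπ).disjoint.mono_right hGk
  refine hmax (Q ⊔ G) ?_ (lt_of_le_of_ne le_sup_left fun h => hG ?_)
  · let f : (Q × G) →ₗ[A] L := Q.subtype.coprod G.subtype
    have hf : Function.Injective f := by
      rw [← LinearMap.ker_eq_bot]
      rw [LinearMap.ker_coprod_of_disjoint_range] <;> simp [hdisj]
    have hr : LinearMap.range f = Q ⊔ G := by simp [f, LinearMap.range_coprod]
    exact Module.Projective.of_equiv (LinearEquiv.ofInjective f hf ≪≫ₗ LinearEquiv.ofEq _ _ hr)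
  · have : G ≤ Q := by rw [h]; exact le_sup_right
    exact eq_bot_iff.2 (fun g hg => Submodule.disjoint_def.1 hdisj g (this hg) hg)

end SplitProjective

/-! ### The abelian category of finitely generated modules -/

section FGModules

variable {A : Type u} [Ring A]

theorem mono_of_injective {X Y : FGModuleCat.{u} A} (f : X ⟶ Y)
    (hf : Function.Injective f.hom.hom) : Mono f := by
  have : Mono ((forget₂ (FGModuleCat.{u} A) (ModuleCat.{u} A)).map f) :=
    (ModuleCat.mono_iff_injective _).2 hf
  exact (forget₂ (FGModuleCat.{u} A) (ModuleCat.{u} A)).mono_of_mono_map this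

theorem epi_of_surjective {X Y : FGModuleCat.{u} A} (f : X ⟶ Y)
    (hf : Function.Surjective f.hom.hom) : Epi f := by
  have : Epi ((forget₂ (FGModuleCat.{u} A) (ModuleCat.{u} A)).map f) :=
    (ModuleCat.epi_iff_surjective _).2 hf
  exact (forget₂ (FGModuleCat.{u} A) (ModuleCat.{u} A)).epi_of_epi_map this

/-- Every finitely generated module is a quotient of a free one. -/
theorem exists_free_epi (X : FGModuleCat.{u} A) :
    ∃ (r : ℕ) (p : FGModuleCat.of A (Fin r → A) ⟶ X), Epi p := by
  obtain ⟨r, p, hp⟩ := Module.Finite.exists_fin' A X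
  exact ⟨r, FGModuleCat.ofHom p, epi_of_surjective _ hp⟩

theorem module_of_projective (X : FGModuleCat.{u} A) [Projective X] : Module.Projective A X := by
  obtain ⟨r, p, hp⟩ := exists_free_epi X
  refine Module.Projective.of_split (M := Fin r → A) (Projective.factorThru (𝟙 X) p).hom.hom
    p.hom.hom ?_
  exact congrArg (fun f => f.hom.hom) (Projective.factorThru_comp (𝟙 X) p)

variable [IsNoetherianRing A]

theorem injective_of_mono {X Y : FGModuleCat.{u} A} (f : X ⟶ Y) [Mono f] :
    Function.Injective f.hom.hom :=
  (ModuleCat.mono_iff_injective _).1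
    (inferInstance : Mono ((forget₂ (FGModuleCat.{u} A) (ModuleCat.{u} A)).map f))

theorem surjective_of_epi {X Y : FGModuleCat.{u} A} (f : X ⟶ Y) [Epi f] :
    Function.Surjective f.hom.hom :=
  (ModuleCat.epi_iff_surjective _).1
    (inferInstance : Epi ((forget₂ (FGModuleCat.{u} A) (ModuleCat.{u} A)).map f))

theorem projective_of_module {X : FGModuleCat.{u} A} (hX : Module.Projective A X) :
    Projective X where
  factors f e _ := by
    obtain ⟨g, hg⟩ := Module.projective_lifting_property e.hom.hom f.hom.hom (surjective_of_epi e)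
    exact ⟨FGModuleCat.ofHom g, FGModuleCat.hom_ext hg⟩

instance enoughProjectives_fgModuleCat : EnoughProjectives (FGModuleCat.{u} A) where
  presentation X := by
    obtain ⟨r, p, hp⟩ := exists_free_epi X
    have := projective_of_module (X := FGModuleCat.of A (Fin r → A))
      (inferInstanceAs (Module.Projective A (Fin r → A)))
    exact ⟨⟨_, p⟩⟩

end FGModules

/-! ### Membership in `add(M)` -/

section InAdd

variable {C : Type u} [Category.{v} C] [Abelian C]

attribute [local instance] Abelian.hasFiniteBiproducts

/-- An object is in `add(M)` if its identity is a sum of maps that factor through objects of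
`add(M)`. -/
theorem inAdd_of_sum {M X : C} {ι : Type} [Fintype ι] {Z : ι → C} (hZ : ∀ i, InAdd M (Z i))
    (f : ∀ i, X ⟶ Z i) (g : ∀ i, Z i ⟶ X) (h : ∑ i, f i ≫ g i = 𝟙 X) : InAdd M X := by
  choose n hn using hZ
  let R := fun i => (hn i).some
  let e := Fintype.equivFin (Σ i, Fin (n i))
  refine ⟨_, ⟨⟨biproduct.lift fun p => f (e.symm p).1 ≫ (R (e.symm p).1).i ≫
      biproduct.π _ (e.symm p).2,
    biproduct.desc fun p => biproduct.ι (fun _ => M) (e.symm p).2 ≫ (R (e.symm p).1).r ≫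
      g (e.symm p).1, ?_⟩⟩⟩
  rw [biproduct.lift_desc, e.symm.sum_comp (fun q : Σ i, Fin (n i) =>
    (f q.1 ≫ (R q.1).i ≫ biproduct.π _ q.2) ≫ biproduct.ι (fun _ => M) q.2 ≫ (R q.1).r ≫ g q.1),
    Fintype.sum_sigma, ← h]
  refine Finset.sum_congr rfl fun i _ => ?_
  have h1 := biproduct.total (f := fun _ : Fin (n i) => M)
  calc _ = f i ≫ (R i).i ≫ (∑ j, biproduct.π (fun _ : Fin (n i) => M) j ≫
        biproduct.ι (fun _ => M) j) ≫ (R i).r ≫ g i := by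
        simp only [Preadditive.sum_comp, Preadditive.comp_sum, Category.assoc]
    _ = _ := by rw [h1, Category.id_comp, (R i).retract_assoc]

theorem inAdd_self (M : C) : InAdd M M :=
  ⟨1, ⟨biproduct.ι (fun _ : Fin 1 => M) 0, biproduct.π (fun _ : Fin 1 => M) 0, by simp⟩⟩

/-- The criterion `inAdd_of_sum` for modules. -/
theorem inAdd_of_sum_linearMap {A : Type u} [Ring A] [IsNoetherianRing A] {M X : FGModuleCat.{u} A}
    {ι : Type} [Fintype ι] {Z : ι → FGModuleCat.{u} A} (hZ : ∀ i, InAdd M (Z i))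
    (f : ∀ i, X →ₗ[A] Z i) (g : ∀ i, Z i →ₗ[A] X) (h : ∀ x, ∑ i, g i (f i x) = x) :
    InAdd M X := by
  refine inAdd_of_sum hZ (fun i => FGModuleCat.ofHom (f i)) (fun i => FGModuleCat.ofHom (g i)) ?_
  let φ : (X ⟶ X) →+ (X →ₗ[A] X) := AddMonoidHom.mk' (fun f => f.hom.hom) (fun _ _ => rfl)
  refine FGModuleCat.hom_ext (?_ : φ _ = LinearMap.id)
  rw [map_sum]
  ext x
  rw [LinearMap.sum_apply]
  exact h x

end InAdd

/-! ### Approximations by the modules `A ⧸ J ^ j` -/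

section LoewyLength

variable {A : Type u} [Ring A]

open Ring

/-- The `j`-th term of the socle series: the elements of `L` that are killed by `J ^ j`. -/
def soc (A : Type u) [Ring A] (L : Type*) [AddCommGroup L] [Module A L] (j : ℕ) :
    Submodule A L where
  carrier := {x | ∀ a ∈ jacobson A ^ j, a • x = 0}
  add_mem' hx hy a ha := by rw [smul_add, hx a ha, hy a ha, add_zero]
  zero_mem' a _ := smul_zero a
  smul_mem' r x hx a ha := by
    rw [← mul_smul]
    exact hx _ (Ideal.mul_mem_right _ _ ha)

theorem soc_mono {L : Type*} [AddCommGroup L] [Module A L] {i j : ℕ} (h : i ≤ j) :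
    soc A L i ≤ soc A L j := fun _ hx a ha => hx a (Ideal.pow_le_pow_right h ha)

theorem map_mem_soc {L L' : Type*} [AddCommGroup L] [Module A L] [AddCommGroup L'] [Module A L']
    (f : L →ₗ[A] L') {j : ℕ} {x : L} (hx : x ∈ soc A L j) : f x ∈ soc A L' j := fun a ha => by
  rw [← map_smul, hx a ha, map_zero]

theorem soc_quotient (j : ℕ) (x : A ⧸ (jacobson A ^ j)) :
    x ∈ soc A (A ⧸ (jacobson A ^ j)) j := by
  intro a ha
  obtain ⟨x, rfl⟩ := Submodule.mkQ_surjective _ x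
  rw [← map_smul, Submodule.mkQ_apply, Submodule.Quotient.mk_eq_zero]
  exact Ideal.mul_mem_right _ _ ha

/-- The map out of `A ⧸ J ^ j` that sends `1` to a given element of the `j`-th socle layer. -/
def ofSoc {L : Type*} [AddCommGroup L] [Module A L] {j : ℕ} (x : L) (hx : x ∈ soc A L j) :
    (A ⧸ (jacobson A ^ j)) →ₗ[A] L :=
  Submodule.liftQ _ (LinearMap.toSpanSingleton A L x) fun a ha => hx a ha

theorem ofSoc_mk {L : Type*} [AddCommGroup L] [Module A L] {j : ℕ} (x : L) (hx : x ∈ soc A L j)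
    (a : A) : ofSoc x hx (Submodule.Quotient.mk a) = a • x := rfl

/-- The test module `⨁ A ⧸ J ^ j`, where `j ≤ n`. -/
def loewyModule (A : Type u) [Ring A] (n : ℕ) : FGModuleCat.{u} A :=
  FGModuleCat.of A (∀ j : Fin (n + 1), A ⧸ (jacobson A ^ (j : ℕ)))

/-- A surjection that lifts the elements of all socle layers also lifts the maps from
`⨁ A ⧸ J ^ j`. -/
theorem exists_lift_loewyModule {n : ℕ} {N L : FGModuleCat.{u} A} (φ : N ⟶ L)
    (h : ∀ (j : ℕ), ∀ x ∈ soc A L j, ∃ y ∈ soc A N j, φ.hom.hom y = x)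
    (f : loewyModule A n ⟶ L) : ∃ g, g ≫ φ = f := by
  classical
  let f' : (∀ j : Fin (n + 1), A ⧸ (jacobson A ^ (j : ℕ))) →ₗ[A] L := f.hom.hom
  have h1 (j : Fin (n + 1)) := h j (f' (LinearMap.single A
    (fun j : Fin (n + 1) => A ⧸ (jacobson A ^ (j : ℕ))) j (Submodule.Quotient.mk 1)))
    (map_mem_soc _ (map_mem_soc _ (soc_quotient _ _)))
  choose y hy hyx using h1
  refine ⟨FGModuleCat.ofHom (LinearMap.lsum A
    (fun j : Fin (n + 1) => A ⧸ (jacobson A ^ (j : ℕ))) ℕ fun j => ofSoc (y j) (hy j)),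
    FGModuleCat.hom_ext ?_⟩
  refine LinearMap.pi_ext' fun j => Submodule.linearMap_qext _ (LinearMap.ext_ring ?_)
  refine Eq.trans ?_ (hyx j)
  refine congrArg φ.hom.hom ?_
  exact (LinearMap.lsum_piSingle A (fun j : Fin (n + 1) => A ⧸ (jacobson A ^ (j : ℕ))) ℕ
    (fun j => ofSoc (y j) (hy j)) j _).trans (one_smul A (y j))

variable [IsArtinianRing A]

theorem inAdd_factor {ι : Type} [Finite ι] (Z : ι → FGModuleCat.{u} A) (i : ι) :
    InAdd (FGModuleCat.of A (∀ i, Z i)) (Z i) := by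
  classical
  refine inAdd_of_sum_linearMap (ι := Unit) (fun _ => inAdd_self _)
    (fun _ => LinearMap.single A (fun i => (Z i : Type u)) i)
    (fun _ => LinearMap.proj (φ := fun i => (Z i : Type u)) i) fun x => ?_
  rw [Fintype.sum_unique]
  exact LinearMap.congr_fun (LinearMap.proj_comp_single_same A (fun i => (Z i : Type u)) i) x

theorem inAdd_quotient {n j : ℕ} (hj : j ≤ n) :
    InAdd (loewyModule A n) (FGModuleCat.of A (A ⧸ (jacobson A ^ j))) :=
  inAdd_factor (fun j : Fin (n + 1) => FGModuleCat.of A (A ⧸ (jacobson A ^ (j : ℕ))))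
    ⟨j, Nat.lt_succ_of_le hj⟩

theorem inAdd_pi {M : FGModuleCat.{u} A} {ι : Type} [Finite ι] (Z : ι → FGModuleCat.{u} A)
    (hZ : ∀ i, InAdd M (Z i)) : InAdd M (FGModuleCat.of A (∀ i, Z i)) := by
  classical
  have := Fintype.ofFinite ι
  refine inAdd_of_sum_linearMap hZ (fun i => LinearMap.proj (φ := fun i => (Z i : Type u)) i)
    (fun i => LinearMap.single A (fun i => (Z i : Type u)) i) fun x => ?_
  exact LinearMap.sum_single_apply _ _

theorem inAdd_prod {M X Y : FGModuleCat.{u} A} (hX : InAdd M X) (hY : InAdd M Y) :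
    InAdd M (FGModuleCat.of A (X × Y)) :=
  inAdd_of_sum_linearMap (ι := Bool) (Z := fun b => bif b then X else Y)
    (fun b => by cases b <;> assumption)
    (fun b => match b with
      | true => LinearMap.fst A X Y
      | false => LinearMap.snd A X Y)
    (fun b => match b with
      | true => LinearMap.inl A X Y
      | false => LinearMap.inr A X Y) fun x => by
    rw [Fintype.sum_bool]
    exact Prod.ext (add_zero _) (zero_add _)

/-- `Y ⧸ J ^ j Y` is in the additive closure of `A ⧸ J ^ j` if `Y` is projective. -/
theorem inAdd_quotient_smul_top {n j : ℕ} (hj : j ≤ n) (Y : Type u) [AddCommGroup Y] [Module A Y]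
    [Module.Finite A Y] [Module.Projective A Y] :
    InAdd (loewyModule A n)
      (FGModuleCat.of A (Y ⧸ (jacobson A ^ j • (⊤ : Submodule A Y)))) := by
  obtain ⟨r, π, hπ⟩ := Module.Finite.exists_fin' A Y
  obtain ⟨s, hs⟩ := Module.projective_lifting_property π LinearMap.id hπ
  have hle (i : Fin r) : jacobson A ^ j • (⊤ : Submodule A Y) ≤
      Submodule.comap (LinearMap.proj i ∘ₗ s) (jacobson A ^ j) := by
    rw [Submodule.smul_le]
    intro a ha y _
    rw [Submodule.mem_comap, map_smul]
    exact Ideal.mul_mem_right _ _ ha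
  have hmem (i : Fin r) : Submodule.Quotient.mk (π (Pi.single i 1)) ∈
      soc A (Y ⧸ (jacobson A ^ j • (⊤ : Submodule A Y))) j := fun a ha => by
    rw [← Submodule.Quotient.mk_smul, Submodule.Quotient.mk_eq_zero]
    exact Submodule.smul_mem_smul ha trivial
  refine inAdd_of_sum_linearMap (Z := fun _ : Fin r => FGModuleCat.of A (A ⧸ (jacobson A ^ j)))
    (fun i => inAdd_quotient hj) (fun i => Submodule.mapQ _ _ (LinearMap.proj i ∘ₗ s) (hle i))
    (fun i => ofSoc _ (hmem i)) ?_
  intro x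
  obtain ⟨y, rfl⟩ := Submodule.mkQ_surjective _ x
  have h1 : y = ∑ i, s y i • π (Pi.single i 1) := by
    conv_lhs => rw [← LinearMap.id_apply (R := A) y, ← hs, LinearMap.comp_apply,
      pi_eq_sum_univ' (s y), map_sum]
    simp
  have h2 (i : Fin r) : ofSoc _ (hmem i) (Submodule.mapQ _ _ (LinearMap.proj i ∘ₗ s) (hle i)
      (Submodule.mkQ _ y)) = Submodule.mkQ _ (s y i • π (Pi.single i 1)) := rfl
  calc _ = ∑ i, Submodule.mkQ (jacobson A ^ j • (⊤ : Submodule A Y))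
        (s y i • π (Pi.single i 1)) := Finset.sum_congr rfl fun i _ => h2 i
    _ = _ := by rw [← map_sum, ← h1]

/-- A module of Loewy length at most `m + 1` has a surjective approximation by `A ⧸ J ^ j`, `j ≤ n`,
whose kernel has Loewy length at most `m`. The approximation is the sum of `Y ⧸ J ^ (m + 1) Y`, where
`Y` is a projective cover of `L` modulo its `m`-th socle layer, and of a module that takes care of
the maps from `A ⧸ J ^ j` with `j ≤ m`. -/
theorem exists_approximation {n m : ℕ} (hm : m + 1 ≤ n) (L : FGModuleCat.{u} A)
    (hL : soc A L (m + 1) = ⊤) :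
    ∃ (N : FGModuleCat.{u} A) (φ : N →ₗ[A] L), InAdd (loewyModule A n) N ∧
      Function.Surjective φ ∧ LinearMap.ker φ ≤ soc A N m ∧
      ∀ (j : ℕ), ∀ x ∈ soc A L j, ∃ y ∈ soc A N j, φ y = x := by
  classical
  -- a projective cover of `L` modulo the socle layer, lifted to `L`
  obtain ⟨Y, _, _, _, _, f, hf, hker⟩ := exists_projective_cover (A := A) (L ⧸ soc A L m)
  obtain ⟨p, hp⟩ := Module.projective_lifting_property (soc A L m).mkQ f (Submodule.mkQ_surjective _)
  let W : Submodule A Y := jacobson A ^ (m + 1) • ⊤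
  have hW : W ≤ LinearMap.ker p := Submodule.smul_le.2 fun a ha y _ => by
    rw [LinearMap.mem_ker, map_smul]
    exact (hL.ge trivial : p y ∈ soc A L (m + 1)) a ha
  have hY : soc A (Y ⧸ W) (m + 1) = ⊤ := eq_top_iff.2 fun y _ a ha => by
    obtain ⟨y, rfl⟩ := Submodule.mkQ_surjective _ y
    rw [← map_smul, Submodule.mkQ_apply, Submodule.Quotient.mk_eq_zero]
    exact Submodule.smul_mem_smul ha trivial
  -- generators of the socle layers
  have hfg (j : Fin (m + 1)) : ∃ (r : ℕ) (x : Fin r → L),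
      Submodule.span A (Set.range x) = soc A L j :=
    Submodule.fg_iff_exists_fin_generating_family.1 (IsNoetherian.noetherian _)
  choose r x hx using hfg
  have hxs (q : Σ j, Fin (r j)) : x q.1 q.2 ∈ soc A L q.1 :=
    hx q.1 ▸ Submodule.subset_span (Set.mem_range_self _)
  let Z : (Σ j, Fin (r j)) → FGModuleCat.{u} A := fun q => .of A (A ⧸ (jacobson A ^ (q.1 : ℕ)))
  let ψ : (∀ q, Z q) →ₗ[A] L := LinearMap.lsum A (fun q => (Z q : Type u)) ℕ
    fun q => ofSoc _ (hxs q)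
  have hZ : soc A (∀ q, Z q) m = ⊤ := eq_top_iff.2 fun z _ a ha => by
    funext q
    exact soc_mono (Nat.lt_succ_iff.1 q.1.2) (soc_quotient _ (z q)) a ha
  have hlift (j : ℕ) (hj : j ≤ m) : ∀ y ∈ soc A L j, ∃ z ∈ soc A (∀ q, Z q) j, ψ z = y := by
    intro y hy
    have hy' : y ∈ soc A L ((⟨j, Nat.lt_succ_of_le hj⟩ : Fin (m + 1)) : ℕ) := hy
    rw [← hx] at hy'
    refine Submodule.span_le (p := (soc A (∀ q, Z q) j).map ψ).2 ?_ hy'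
    rintro _ ⟨i, rfl⟩
    let q : Σ j, Fin (r j) := ⟨⟨j, Nat.lt_succ_of_le hj⟩, i⟩
    refine ⟨LinearMap.single A (fun q => (Z q : Type u)) q (Submodule.Quotient.mk 1), ?_, ?_⟩
    · exact map_mem_soc _ (soc_quotient _ _)
    · have h1 : ψ (LinearMap.single A (fun q => (Z q : Type u)) q (Submodule.Quotient.mk 1)) =
          ofSoc _ (hxs q) (Submodule.Quotient.mk 1) :=
        LinearMap.lsum_piSingle A (fun q => (Z q : Type u)) ℕ _ q _
      rw [h1, ofSoc_mk, one_smul]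
  let φ : ((Y ⧸ W) × (∀ q, Z q)) →ₗ[A] L := (W.liftQ p hW).coprod ψ
  have hsurj : Function.Surjective φ := by
    intro l
    obtain ⟨y, hy⟩ := hf ((soc A L m).mkQ l)
    have h1 : l - p y ∈ soc A L m := by
      rw [← Submodule.Quotient.mk_eq_zero, ← Submodule.mkQ_apply, map_sub, ← hy, ← hp]
      exact sub_self _
    obtain ⟨z, -, hz⟩ := hlift m le_rfl _ h1
    refine ⟨(W.mkQ y, z), ?_⟩
    rw [LinearMap.coprod_apply, hz]
    exact add_sub_cancel _ _
  refine ⟨.of A ((Y ⧸ W) × (∀ q, Z q)), φ, inAdd_prod (X := .of A (Y ⧸ W)) (Y := .of A (∀ q, Z q))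
    (inAdd_quotient_smul_top hm Y)
    (inAdd_pi Z fun q => inAdd_quotient (by omega)), hsurj, ?_, ?_⟩
  · rintro ⟨y, z⟩ hyz a ha
    refine Prod.ext ?_ ((hZ.ge trivial : z ∈ soc A _ m) a ha)
    obtain ⟨y, rfl⟩ := W.mkQ_surjective y
    have h1 : p y + ψ z = 0 := hyz
    have h2 : p y ∈ soc A L m := by
      rw [eq_neg_of_add_eq_zero_left h1]
      exact neg_mem (map_mem_soc _ (hZ.ge trivial))
    have h3 : f y = 0 := by
      rw [← hp]
      exact (Submodule.Quotient.mk_eq_zero _).2 h2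
    have h4 : a • y ∈ jacobson A ^ m • (jacobson A • (⊤ : Submodule A Y)) :=
      Submodule.smul_mem_smul ha (hker h3)
    rw [← Submodule.mul_smul, ← Submodule.pow_succ] at h4
    exact (Submodule.Quotient.mk_eq_zero W).2 h4
  · intro j l hl
    by_cases hj : j ≤ m
    · obtain ⟨z, hz, rfl⟩ := hlift j hj l hl
      exact ⟨(0, z), map_mem_soc (LinearMap.inr A (Y ⧸ W) (∀ q, Z q)) hz, by simp [φ]⟩
    · obtain ⟨⟨y, z⟩, rfl⟩ := hsurj l
      refine ⟨(y, z), fun a ha => ?_, rfl⟩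
      exact Prod.ext (soc_mono (by omega : m + 1 ≤ j) (hY.ge trivial) a ha)
        (soc_mono (by omega : m ≤ j) (hZ.ge trivial) a ha)

end LoewyLength

/-! ### The representation dimension and the Loewy length -/

section LoewyResolution

variable {A : Type u} [Ring A] [IsArtinianRing A]

open Ring

theorem ResLen.of_cover {n t : ℕ} {N L : FGModuleCat.{u} A} (φ : N ⟶ L)
    (hN : InAdd (loewyModule A n) N) (hφ : Function.Surjective φ.hom.hom)
    (hlift : ∀ (j : ℕ), ∀ x ∈ soc A L j, ∃ y ∈ soc A N j, φ.hom.hom y = x)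
    (hker : ResLen (loewyModule A n) t (kernel φ)) : ResLen (loewyModule A n) (t + 1) L := by
  have := epi_of_surjective φ hφ
  exact ⟨kernel φ, N, kernel.ι φ, φ, kernel.condition φ, shortExact_kernel φ, hN,
    exists_lift_loewyModule φ hlift, hker⟩

theorem soc_kernel_eq_top {N L : FGModuleCat.{u} A} (φ : N ⟶ L) {m : ℕ}
    (h : LinearMap.ker φ.hom.hom ≤ soc A N m) :
    soc A (kernel φ : FGModuleCat.{u} A) m = ⊤ := by
  refine eq_top_iff.2 fun x _ a ha => injective_of_mono (kernel.ι φ) ?_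
  rw [map_smul, map_zero]
  refine h ?_ a ha
  exact LinearMap.congr_fun (congrArg (fun f => f.hom.hom) (kernel.condition φ)) x

/-- Modules of Loewy length at most `m` have a resolution of length `m`. -/
theorem resLen_of_soc_eq_top {n m : ℕ} (hm : m ≤ n) (L : FGModuleCat.{u} A)
    (hL : soc A L m = ⊤) : ResLen (loewyModule A n) m L := by
  induction m generalizing L with
  | zero =>
    refine (IsZero.iff_id_eq_zero L).2 (FGModuleCat.hom_ext (LinearMap.ext fun x => ?_))
    have h1 := (hL.ge trivial : x ∈ soc A L 0) 1 (by
      rw [Submodule.pow_zero, Ideal.one_eq_top]; trivial)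
    rw [one_smul] at h1
    exact h1
  | succ m ih =>
    obtain ⟨N, φ, hN, hφ, hker, hlift⟩ := exists_approximation hm L hL
    exact ResLen.of_cover (FGModuleCat.ofHom φ) hN hφ hlift
      (ih (by omega) _ (soc_kernel_eq_top _ hker))

theorem inAdd_of_projective {n : ℕ} (hn : jacobson A ^ n = ⊥) (Q : FGModuleCat.{u} A)
    (hQ : Module.Projective A Q) : InAdd (loewyModule A n) Q := by
  have h0 : jacobson A ^ n • (⊤ : Submodule A Q) = ⊥ := by rw [hn, Submodule.bot_smul]
  let e := Submodule.quotEquivOfEqBot _ h0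
  refine inAdd_of_sum_linearMap (ι := Unit) (fun _ => inAdd_quotient_smul_top le_rfl Q)
    (fun _ => e.symm.toLinearMap) (fun _ => e.toLinearMap) fun x => ?_
  rw [Fintype.sum_unique]
  exact e.apply_symm_apply x

/-- Over a self-injective ring of Loewy length at most `m + 2`, the projective direct summands
shorten the resolutions by one. -/
theorem resLen_of_injective (hA : Module.Injective A A) {m : ℕ}
    (hm : jacobson A ^ (m + 2) = ⊥) (L : FGModuleCat.{u} A) :
    ResLen (loewyModule A (m + 2)) (m + 1) L := by
  obtain ⟨Q, L', hQL, hQ, hL'⟩ := exists_isCompl_projective hA hm L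
  obtain ⟨N, φ, hN, hφ, hker, hlift⟩ := exists_approximation (n := m + 2) (m := m) (by omega)
    (.of A L') (eq_top_iff.2 fun x _ a ha => Subtype.ext (hL' a ha x x.2))
  let e := Submodule.prodEquivOfIsCompl Q L' hQL
  let p : (Q × N) →ₗ[A] L := e.toLinearMap ∘ₗ LinearMap.prodMap LinearMap.id φ
  refine ResLen.of_cover (N := .of A (Q × N)) (FGModuleCat.ofHom p)
    (inAdd_prod (X := .of A Q) (inAdd_of_projective hm _ hQ) hN) ?_ ?_
    (resLen_of_soc_eq_top (by omega) _ (soc_kernel_eq_top _ ?_))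
  · refine e.surjective.comp ?_
    rintro ⟨q, l⟩
    obtain ⟨x, rfl⟩ := hφ l
    exact ⟨(q, x), rfl⟩
  · intro j x hx
    obtain ⟨y, hy, hyx⟩ := hlift j _ (map_mem_soc (LinearMap.snd A Q L' ∘ₗ e.symm.toLinearMap) hx)
    have h1 := map_mem_soc (LinearMap.fst A Q L' ∘ₗ e.symm.toLinearMap) hx
    refine ⟨((e.symm x).1, y), fun a ha => Prod.ext (h1 a ha) (hy a ha), ?_⟩
    refine (congrArg e (Prod.ext rfl hyx : ((e.symm x).1, φ y) = e.symm x)).trans ?_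
    exact e.apply_symm_apply x
  · rintro ⟨q, y⟩ hqy a ha
    have h1 : ((q, φ y) : Q × L') = 0 := e.map_eq_zero_iff.1 hqy
    obtain ⟨rfl, h2⟩ := Prod.mk.inj h1
    exact Prod.ext (smul_zero a) (hker h2 a ha)

end LoewyResolution

section Approximation

/-- Over a finite-dimensional algebra, the maps into a finite-dimensional module `M` factor through
a single map to a power of `M`. -/
theorem exists_left_approximation (k : Type v) [Field k] {A : Type u} [Ring A] [Algebra k A]
    [Module.Finite k A] (X M : Type u) [AddCommGroup X] [Module A X] [Module.Finite A X]
    [AddCommGroup M] [Module A M] [Module.Finite A M] :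
    ∃ (r : ℕ) (f : X →ₗ[A] (Fin r → M)), ∀ g : X →ₗ[A] M, ∃ h : (Fin r → M) →ₗ[A] M,
      h ∘ₗ f = g := by
  let _ : Module k X := Module.compHom X (algebraMap k A)
  let _ : Module k M := Module.compHom M (algebraMap k A)
  have : IsScalarTower k A X := ⟨fun c a x => by
    rw [Algebra.smul_def, mul_smul]; rfl⟩
  have : IsScalarTower k A M := ⟨fun c a x => by
    rw [Algebra.smul_def, mul_smul]; rfl⟩
  have : Module.Finite k X := .trans A X
  have : Module.Finite k M := .trans A M
  have : Module.Finite k (X →ₗ[A] M) :=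
    .of_injective (LinearMap.restrictScalarsₗ k A X M k) (LinearMap.restrictScalars_injective k)
  obtain ⟨r, f, hf⟩ := Submodule.fg_iff_exists_fin_generating_family.1
    (Module.Finite.fg_top (R := k) (M := X →ₗ[A] M))
  refine ⟨r, LinearMap.pi f, fun g => ?_⟩
  have hg : g ∈ Submodule.span k (Set.range f) := hf ▸ Submodule.mem_top
  obtain ⟨c, rfl⟩ := (Submodule.mem_span_range_iff_exists_fun k).1 hg
  refine ⟨∑ i, c i • LinearMap.proj i, ?_⟩
  ext x
  simp

/-- The representation dimension of a self-injective algebra is at most its Loewy length. -/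
theorem repdim_le_loewyLength (k : Type v) [Field k] {A : Type u} [Ring A] [Algebra k A]
    [Module.Finite k A] [IsNoetherianRing A] (hA : Module.Injective A A)
    (hns : ¬ IsSemisimpleRing A) : repdim (FGModuleCat.{u} A) ≤ loewyLength A := by
  have : IsArtinianRing A := IsArtinianRing.of_finite k A
  refine le_sInf ?_
  rintro _ ⟨i, rfl, hi⟩
  obtain ⟨m, rfl⟩ : ∃ m, i = m + 2 := by
    obtain _ | _ | m := i
    · refine absurd (isSemisimpleModule_of_jacobson_smul_eq_zero fun a _ x => ?_) hns
      have : (1 : A) ∈ (⊥ : Ideal A) := by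
        rw [← hi, Submodule.pow_zero, Ideal.one_eq_top]; trivial
      have h1 : (1 : A) = 0 := this
      rw [smul_eq_mul, ← mul_one (a * x), h1, mul_zero]
    · refine absurd (isSemisimpleModule_of_jacobson_smul_eq_zero fun a ha x => ?_) hns
      rw [zero_add, Submodule.pow_one] at hi
      rw [hi] at ha
      rw [(ha : a = 0), zero_smul]
    · exact ⟨m, rfl⟩
  refine repdim_le (M := loewyModule A (m + 2)) (t := m) (resLen_of_injective hA hi)
    (fun X => ?_) (fun X => ?_)
  · obtain ⟨r, p, hp⟩ := exists_free_epi X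
    exact ⟨_, p, inAdd_of_projective hi _ (inferInstanceAs (Module.Projective A (Fin r → A))), hp⟩
  · obtain ⟨r, f, hf⟩ := exists_left_approximation (A := A) k X (loewyModule A (m + 2))
    refine ⟨.of A (Fin r → loewyModule A (m + 2)), FGModuleCat.ofHom f,
      inAdd_pi (fun _ => loewyModule A (m + 2)) fun _ => inAdd_self _, ?_, fun g => ?_⟩
    · refine mono_of_injective _ ((injective_iff_map_eq_zero f).2 fun x hx => ?_)
      -- maps to `A` separate points, and `A` embeds into the test module
      by_contra hx0
      obtain ⟨g, hg⟩ := exists_ne_zero_of_ne_zero hA hx0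
      let ι : A →ₗ[A] loewyModule A (m + 2) := LinearMap.pi fun _ => Submodule.mkQ _
      obtain ⟨h, hh⟩ := hf (ι ∘ₗ g)
      have h1 : ι (g x) = 0 := by
        rw [← LinearMap.comp_apply, ← hh, LinearMap.comp_apply, hx, map_zero]
      have h2 := (Submodule.Quotient.mk_eq_zero _).1 (congrFun h1 (Fin.last _))
      rw [Fin.val_last, hi] at h2
      exact hg h2
    · obtain ⟨h, hh⟩ := hf g.hom.hom
      exact ⟨FGModuleCat.ofHom h, FGModuleCat.hom_ext hh⟩

end Approximation

/-! ### The stable category -/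

section StableCategory

variable (A : Type u) [Ring A]

theorem stableRel_add [IsNoetherianRing A] {X Y : FGModuleCat.{u} A} {f₁ f₂ g₁ g₂ : X ⟶ Y}
    (h₁ : stableRel A f₁ f₂) (h₂ : stableRel A g₁ g₂) :
    stableRel A (f₁ + g₁) (f₂ + g₂) := by
  obtain ⟨P, a, b, hP, hab⟩ := h₁
  obtain ⟨Q, c, d, hQ, hcd⟩ := h₂
  have := projective_of_module hP
  have := projective_of_module hQ
  exact ⟨P ⊞ Q, biprod.lift a c, biprod.desc b d, module_of_projective _, by
    rw [biprod.lift_desc, hab, hcd]; abel⟩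

instance congruence_stableRel [IsNoetherianRing A] : Congruence (stableRel A) where
  equivalence {X Y} :=
    { refl f := ⟨.of A PUnit, 0, 0, (inferInstance : Module.Projective A PUnit.{u + 1}), by simp⟩
      symm := by
        rintro f g ⟨P, a, b, hP, hab⟩
        exact ⟨P, -a, b, hP, by rw [Preadditive.neg_comp, hab, neg_sub]⟩
      trans := by
        intro f g h hfg hgh
        obtain ⟨P, a, b, hP, hab⟩ := stableRel_add A hfg hgh
        exact ⟨P, a, b, hP, by rw [hab]; abel⟩ }
  comp_left := by
    rintro X Y Z f g g' ⟨P, a, b, hP, hab⟩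
    exact ⟨P, f ≫ a, b, hP, by rw [Category.assoc, hab, Preadditive.comp_sub]⟩
  comp_right := by
    rintro X Y Z f f' g ⟨P, a, b, hP, hab⟩
    exact ⟨P, a, b ≫ g, hP, by rw [reassoc_of% hab, Preadditive.sub_comp]⟩

variable [IsNoetherianRing A]

theorem isStabilization_toStab : IsStabilization (stabTriangleData A) (toStab A) where
  isZero P hP := by
    have h0 : (toStab A).map (𝟙 P) = (toStab A).map 0 :=
      CategoryTheory.Quotient.sound _ ⟨P, 𝟙 P, 𝟙 P, module_of_projective P, by simp⟩
    have h1 : 𝟙 ((toStab A).obj P) = (toStab A).map 0 := by rw [← h0, CategoryTheory.Functor.map_id]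
    have hz : IsZero (FGModuleCat.of A PUnit : FGModuleCat.{u} A) :=
      (IsZero.iff_id_eq_zero _).2 (by ext)
    let _ := Quotient.preadditive (stableRel A) fun _ _ _ _ _ _ => stableRel_add A
    have := Quotient.functor_additive (stableRel A) fun _ _ _ _ _ _ => stableRel_add A
    rw [IsZero.iff_id_eq_zero, h1]
    exact (toStab A).map_zero _ _
  isShift S hS _ := ⟨S, hS, module_of_projective _, ⟨Iso.refl _⟩, ⟨Iso.refl _⟩⟩
  isTriangle S hS := ⟨S, hS, Iso.refl _, Iso.refl _, Iso.refl _, by simp, by simp⟩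

/-- The bound for the stable category. Its objects are modules, so every object is in the image of
the stabilization functor. -/
theorem two_add_dimStab_le_wrepdim : 2 + dimStab A ≤ wrepdim (FGModuleCat.{u} A) := by
  let _ := Quotient.preadditive (stableRel A) fun _ _ _ _ _ _ => stableRel_add A
  have := Quotient.functor_additive (stableRel A) fun _ _ _ _ _ _ => stableRel_add A
  exact (isStabilization_toStab A).two_add_dim_le_wrepdim fun Y => ⟨Y.as, fun _ h => h⟩

end StableCategory

/-! ### Quotients of the bounded derived category -/

section Derived

open DerivedCategory

variable {C : Type u} [Category.{v} C] [Abelian C] [HasDerivedCategory.{max u v} C]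

/-- A complex without cohomology above degree `b` receives a map from a projective object in degree
`b` that is surjective on cohomology in degree `b`. -/
theorem exists_projective_map [EnoughProjectives C] (X : DerivedCategory C) (b : ℤ) [X.IsLE b] :
    ∃ (P : C) (_ : Projective P) (s : (singleFunctor C b).obj P ⟶ X),
      Epi ((homologyFunctor C b).map s) := by
  obtain ⟨K, hK, ⟨e⟩⟩ := exists_iso_Q_obj_of_isLE X b
  have hd : K.d b (b + 1) = 0 := (K.isZero_of_isStrictlyLE b (b + 1) (by omega)).eq_of_tgt _ _
  let f : (HomologicalComplex.single C (ComplexShape.up ℤ) b).obj (Projective.over (K.X b)) ⟶ K :=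
    HomologicalComplex.mkHomFromSingle (Projective.π (K.X b)) (by
      rintro k rfl
      rw [hd, comp_zero])
  have hf : Epi (f.f b) := by
    rw [HomologicalComplex.mkHomFromSingle_f]
    infer_instance
  have h1 : IsIso (K.iCycles b) := K.isIso_iCycles b (b + 1) (by simp) hd
  have h2 : IsIso (((HomologicalComplex.single C (ComplexShape.up ℤ) b).obj
      (Projective.over (K.X b))).iCycles b) :=
    HomologicalComplex.isIso_iCycles _ b (b + 1) (by simp) (by simp)
  have h3 : Epi (HomologicalComplex.cyclesMap f b) := by
    have : HomologicalComplex.cyclesMap f b = HomologicalComplex.iCycles _ b ≫ f.f b ≫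
        inv (K.iCycles b) := by simp [← Category.assoc]
    rw [this]
    infer_instance
  have h4 : Epi (HomologicalComplex.homologyMap f b) := by
    have : Epi (HomologicalComplex.homologyπ _ b ≫ HomologicalComplex.homologyMap f b) := by
      rw [HomologicalComplex.homologyπ_naturality]
      infer_instance
    exact epi_of_epi (HomologicalComplex.homologyπ _ b) _
  have h5 : Epi ((homologyFunctor C b).map (Q.map f)) :=
    ((MorphismProperty.epimorphisms C).arrow_mk_iso_iff
      (((Functor.mapArrowFunctor _ _).mapIso (homologyFunctorFactors C b)).app (Arrow.mk f))).2 h4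
  have h6 : Epi ((homologyFunctor C b).map (Q.map f ≫ e.inv)) := by
    rw [Functor.map_comp]
    infer_instance
  exact ⟨_, inferInstance, Q.map f ≫ e.inv, h6⟩

/-- The embedding of an abelian category into its bounded derived category. -/
noncomputable def boundedSingle (C : Type u) [Category.{v} C] [Abelian C]
    [HasDerivedCategory.{max u v} C] :
    C ⥤ (TStructure.t (C := C)).bounded.FullSubcategory :=
  (TStructure.t (C := C)).bounded.lift (singleFunctor C 0)
    fun _ => ⟨⟨0, inferInstance⟩, ⟨0, inferInstance⟩⟩

instance additive_boundedSingle : (boundedSingle C).Additive where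
  map_add := ObjectProperty.hom_ext _ (singleFunctor C 0).map_add

/-- Short exact sequences give distinguished triangles in the bounded derived category. -/
theorem exists_distinguished (S : ShortComplex C) (hS : S.ShortExact) :
    ∃ h, Triangle.mk ((boundedSingle C).map S.f) ((boundedSingle C).map S.g) h ∈
      distTriang ((TStructure.t (C := C)).bounded.FullSubcategory) := by
  let ι := (TStructure.t (C := C)).bounded.ι
  let d : ι.obj ((boundedSingle C).obj S.X₃) ⟶ ι.obj (((boundedSingle C).obj S.X₁)⟦(1 : ℤ)⟧) :=
    hS.singleδ ≫ (ι.commShiftIso (1 : ℤ)).inv.app ((boundedSingle C).obj S.X₁)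
  refine ⟨ι.preimage d, ?_⟩
  refine isomorphic_distinguished _ hS.singleTriangle_distinguished _
    (Triangle.isoMk _ _ (Iso.refl _) (Iso.refl _) (Iso.refl _) ?_ ?_ ?_)
  · exact (Category.comp_id _).trans (Category.id_comp _).symm
  · exact (Category.comp_id _).trans (Category.id_comp _).symm
  · have h1 : ι.map (ι.preimage d) ≫ (ι.commShiftIso (1 : ℤ)).hom.app ((boundedSingle C).obj S.X₁) =
        hS.singleδ := by
      rw [ι.map_preimage]
      exact (Category.assoc _ _ _).trans ((congrArg (hS.singleδ ≫ ·)
        ((ι.commShiftIso (1 : ℤ)).inv_hom_id_app _)).trans (Category.comp_id _))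
    refine Eq.trans ?_ (Category.id_comp hS.singleδ).symm
    refine Eq.trans ?_ h1
    refine (congrArg (_ ≫ ·) (CategoryTheory.Functor.map_id _ _)).trans ?_
    exact Category.comp_id _

theorem exists_iso_boundedSingle (X : (TStructure.t (C := C)).bounded.FullSubcategory) (n : ℤ)
    (L : C) (e : X.obj ≅ (singleFunctor C n).obj L) :
    Nonempty (X⟦n⟧ ≅ (boundedSingle C).obj L) := by
  let ι := (TStructure.t (C := C)).bounded.ι
  exact ⟨ι.preimageIso ((ι.commShiftIso n).app X ≪≫ (shiftFunctor _ n).mapIso e ≪≫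
    ((singleFunctors C).shiftIso n 0 n (add_zero n)).app L)⟩

variable {T : Type*} [Category* T] [HasShift T ℤ] [Preadditive T]
  [∀ n : ℤ, (shiftFunctor T n).Additive]
  (F : (TStructure.t (C := C)).bounded.FullSubcategory ⥤ T) [F.CommShift ℤ]

/-- A functor that kills the projective objects in degree `0` kills them in all degrees. -/
theorem isZero_of_single
    (hF : ∀ P : C, Projective P → IsZero (F.obj ((boundedSingle C).obj P)))
    (X : (TStructure.t (C := C)).bounded.FullSubcategory) (n : ℤ) (P : C) [hP : Projective P]
    (e : X.obj ≅ (singleFunctor C n).obj P) : IsZero (F.obj X) := by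
  obtain ⟨e'⟩ := exists_iso_boundedSingle X n P e
  have h1 : IsZero ((F.obj X)⟦n⟧) := (hF P hP).of_iso ((F.commShiftIso n).symm.app X ≪≫ F.mapIso e')
  exact ((shiftFunctor T (-n)).map_isZero h1).of_iso ((shiftEquiv T n).unitIso.app _)

variable [HasZeroObject T] [Pretriangulated T] [F.IsTriangulated]

/-- A triangulated functor on the bounded derived category that kills the projective objects is a
stabilization. -/
theorem isStabilization_boundedSingle
    (hF : ∀ P : C, Projective P → IsZero (F.obj ((boundedSingle C).obj P))) :
    IsStabilization (TriangleData.ofPretriangulated T) (boundedSingle C ⋙ F) where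
  isZero := hF
  isShift S hS hP := by
    obtain ⟨h, hh⟩ := exists_distinguished S hS
    have h1 := F.map_distinguished _ hh
    have := (Triangle.isZero₂_iff_isIso₃ _ h1).1 (hF _ hP)
    exact ⟨@asIso _ _ _ _ _ this⟩
  isTriangle S hS := by
    obtain ⟨h, hh⟩ := exists_distinguished S hS
    exact ⟨_, F.map_distinguished _ hh⟩

theorem span_of_shift {Q : ObjectProperty T} (n : ℕ) (X : T)
    (h : (TriangleData.ofPretriangulated T).Span Q (X⟦(n : ℤ)⟧)) :
    (TriangleData.ofPretriangulated T).Span Q X := by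
  induction n with
  | zero => exact .of_iso ((shiftFunctorZero T ℤ).symm.app X) h
  | succ n ih => exact ih (.unshift ⟨(shiftFunctorAdd' T (n : ℤ) 1 _ rfl).app X⟩ h)

theorem span_shift {Q : ObjectProperty T} (n : ℕ) (X : T)
    (h : (TriangleData.ofPretriangulated T).Span Q X) :
    (TriangleData.ofPretriangulated T).Span Q (X⟦(n : ℤ)⟧) := by
  induction n with
  | zero => exact .of_iso ((shiftFunctorZero T ℤ).app X) h
  | succ n ih => exact .shift ⟨(shiftFunctorAdd' T (n : ℤ) 1 _ rfl).app X⟩ ih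

theorem span_of_shift_int {Q : ObjectProperty T} (n : ℤ) (X : T)
    (h : (TriangleData.ofPretriangulated T).Span Q (X⟦n⟧)) :
    (TriangleData.ofPretriangulated T).Span Q X := by
  obtain ⟨n, rfl | rfl⟩ := n.eq_nat_or_neg
  · exact span_of_shift n X h
  · exact .of_iso ((shiftFunctorCompIsoId T (-n : ℤ) n (by simp)).symm.app X) (span_shift n _ h)

/-- Modulo the projective objects, every bounded complex is a shift of an object of `C`: remove the
top cohomology with a projective object in the top degree until only one degree is left. -/
theorem exists_span_of_bounded [EnoughProjectives C]
    (hF : ∀ P : C, Projective P → IsZero (F.obj ((boundedSingle C).obj P))) (n : ℕ) :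
    ∀ (X : (TStructure.t (C := C)).bounded.FullSubcategory) (b : ℤ), X.obj.IsGE (b - n) →
      X.obj.IsLE b → ∃ L : C, ∀ Q : ObjectProperty T,
        (TriangleData.ofPretriangulated T).Span Q (F.obj ((boundedSingle C).obj L)) →
        (TriangleData.ofPretriangulated T).Span Q (F.obj X) := by
  induction n with
  | zero =>
    intro X b h₁ h₂
    rw [Nat.cast_zero, sub_zero] at h₁
    obtain ⟨L, ⟨e⟩⟩ := exists_iso_singleFunctor_obj_of_isGE_of_isLE X.obj b
    obtain ⟨e'⟩ := exists_iso_boundedSingle X b L e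
    exact ⟨L, fun Q hQ => span_of_shift_int b _
      (.of_iso ((F.commShiftIso b).symm.app X ≪≫ F.mapIso e') hQ)⟩
  | succ n ih =>
    intro X b h₁ h₂
    let ι := (TStructure.t (C := C)).bounded.ι
    obtain ⟨P, hP, s, hs⟩ := exists_projective_map X.obj b
    let X₁ : (TStructure.t (C := C)).bounded.FullSubcategory :=
      ⟨(singleFunctor C b).obj P, ⟨b, inferInstance⟩, ⟨b, inferInstance⟩⟩
    let s' : X₁ ⟶ X := ι.preimage s
    obtain ⟨X', g, h, hT⟩ := distinguished_cocone_triangle s'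
    have hs' : Epi ((homologyFunctor C b).map (ι.map s')) := by
      rw [ι.map_preimage]
      exact hs
    have hT' := ι.map_distinguished _ hT
    -- the cohomology of the cone in degrees where the cohomology of `X` has no contribution
    have key (i : ℤ) (hi : i + 1 ≠ b) (hX : (homologyFunctor C i).map (ι.map g) = 0) :
        IsZero ((homologyFunctor C i).obj X'.obj) := by
      refine (HomologySequence.exact₃ _ hT' i (i + 1) rfl).isZero_X₂ hX ?_
      refine IsZero.eq_of_tgt ?_ _ _
      rcases lt_or_gt_of_ne hi with hi | hi
      · exact isZero_of_isGE ((singleFunctor C b).obj P) b _ hi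
      · exact isZero_of_isLE ((singleFunctor C b).obj P) b _ hi
    have hGE : X'.obj.IsGE (b - 1 - n) := (isGE_iff _ _).2 fun i hi => key i (by omega)
      ((isZero_of_isGE X.obj (b - (n + 1 : ℕ)) i (by push_cast; omega)).eq_of_src _ _)
    have hLE : X'.obj.IsLE (b - 1) := (isLE_iff _ _).2 fun i hi => key i (by omega) (by
      rcases eq_or_lt_of_le (show b ≤ i by omega) with rfl | hi
      · exact (HomologySequence.epi_homologyMap_mor₁_iff _ hT' b).1 hs'
      · exact (isZero_of_isLE X.obj b i hi).eq_of_src _ _)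
    obtain ⟨L, hL⟩ := ih X' (b - 1) hGE hLE
    have := (Triangle.isZero₁_iff_isIso₂ _ (F.map_distinguished _ hT)).1
      (isZero_of_single F hF X₁ b P (Iso.refl _))
    exact ⟨L, fun Q hQ => .of_iso (@asIso _ _ _ _ _ this) (hL Q hQ)⟩

/-- The bound for a triangulated quotient of the bounded derived category that kills the projective
objects. -/
theorem two_add_dim_le_wrepdim_of_isTriangulated [EnoughProjectives C] [F.EssSurj]
    (hF : ∀ P : C, Projective P → IsZero (F.obj ((boundedSingle C).obj P))) :
    2 + (TriangleData.ofPretriangulated T).dim ≤ wrepdim C := by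
  refine (isStabilization_boundedSingle F hF).two_add_dim_le_wrepdim fun Y => ?_
  let X := F.objPreimage Y
  obtain ⟨⟨a, ha⟩, ⟨b, hb⟩⟩ := X.property
  obtain ⟨n, hn⟩ : ∃ n : ℕ, b - n ≤ a := ⟨(b - a).toNat, by omega⟩
  obtain ⟨L, hL⟩ := exists_span_of_bounded F hF n X b
    (TStructure.t.isGE_of_ge _ _ _ hn) hb
  exact ⟨L, fun Q hQ => .of_iso (F.objObjPreimageIso Y).symm (hL Q hQ)⟩

end Derived

/-! ### The quotient by the perfect complexes -/

section StableDerived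

open scoped ZeroObject

variable (A : Type u) [Ring A] [IsNoetherianRing A]

theorem isZero_localization_of_perf (X : BoundedDerived A) (hX : perf A X) :
    IsZero ((perf A).trW.Q.obj X) := by
  have h1 : (perf A).trW (0 : 0 ⟶ X) := ⟨X, 𝟙 X, 0, contractible_distinguished₁ X, hX⟩
  have := Localization.inverts (perf A).trW.Q (perf A).trW _ h1
  exact ((perf A).trW.Q.map_isZero (isZero_zero _)).of_iso (@asIso _ _ _ _ _ this).symm

theorem inAdd_regular_of_projective (P : FGModuleCat.{u} A) [Projective P] :
    InAdd (FGModuleCat.of A A) P := by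
  classical
  have := module_of_projective P
  obtain ⟨r, π, hπ⟩ := Module.Finite.exists_fin' A P
  obtain ⟨s, hs⟩ := Module.projective_lifting_property π LinearMap.id hπ
  refine inAdd_of_sum_linearMap (Z := fun _ : Fin r => .of A A) (fun _ => inAdd_self _)
    (fun i => LinearMap.proj i ∘ₗ s) (fun i => π ∘ₗ LinearMap.single A (fun _ => A) i) fun x => ?_
  refine (map_sum π _ _).symm.trans ?_
  exact (congrArg π (LinearMap.sum_single_apply _ (s x))).trans (LinearMap.congr_fun hs x)

/-- The bound for the quotient of the bounded derived category by the perfect complexes. -/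
theorem two_add_dimStableDerived_le_wrepdim :
    2 + dimStableDerived A ≤ wrepdim (FGModuleCat.{u} A) := by
  have : (perf A).trW.Q.EssSurj := Localization.essSurj _ (perf A).trW
  refine two_add_dim_le_wrepdim_of_isTriangulated (perf A).trW.Q fun P hP => ?_
  let Φ := boundedSingle (FGModuleCat.{u} A) ⋙ (perf A).trW.Q
  refine (inAdd_regular_of_projective A P).induct (P := fun X => IsZero (Φ.obj X))
    (fun X hX => Φ.map_isZero hX) (fun X Y hX hY => ?_) (fun X Y r hY => ?_)
    (isZero_localization_of_perf A _ ((ObjectProperty.singleton (regularComplex A)).le_triangEnvelope _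
      ((ObjectProperty.singleton_iff _ _).2 rfl)))
  · rw [IsZero.iff_id_eq_zero, ← Φ.map_id, ← biprod.total, Φ.map_add, Φ.map_comp, Φ.map_comp,
      hX.eq_of_tgt (Φ.map biprod.fst) 0, hY.eq_of_tgt (Φ.map biprod.snd) 0]
    simp
  · rw [IsZero.iff_id_eq_zero, ← Φ.map_id, ← r.retract, Φ.map_comp, hY.eq_of_tgt (Φ.map r.i) 0,
      zero_comp]

end StableDerived

end RepDim

theorem proposition8p6 {k : Type v} [Field k] {A : Type u} [Ring A] [Algebra k A]
    [Module.Finite k A] :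
    haveI : IsNoetherianRing A := IsNoetherianRing.of_finite k A
    2 + RepDim.dimStableDerived A ≤ RepDim.wrepdim (FGModuleCat.{u} A) ∧
    (Module.Injective A A → ¬ IsSemisimpleRing A →
      RepDim.repdim (FGModuleCat.{u} A) ≤ RepDim.loewyLength A ∧
      RepDim.wrepdim (FGModuleCat.{u} A) ≤ RepDim.repdim (FGModuleCat.{u} A) ∧
      2 + RepDim.dimStab A ≤ RepDim.wrepdim (FGModuleCat.{u} A)) := by
  have : IsNoetherianRing A := IsNoetherianRing.of_finite k A
  exact ⟨RepDim.two_add_dimStableDerived_le_wrepdim A, fun hA hns =>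
    ⟨RepDim.repdim_le_loewyLength k hA hns, RepDim.wrepdim_le_repdim _,
      RepDim.two_add_dimStab_le_wrepdim A⟩⟩
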